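/- Definitions. Let $n\ge 0$. An (ordered, oriented) $n$-linkoid diagram is a smooth generic immersion of $n$ enumerated unit intervals $[0,1]$ and finitely many oriented circles into the oriented sphere $S^2$, with finitely many double points, all transverse and away from the endpoints, and with over/under information at each double point. Two diagrams are equivalent if they are related by a finite sequence of: orientation-preserving reparametrizations of the components and renumberings of the closed components; isotopies of $S^2$; oriented Reidemeister moves I, II, III (in all variants), performed inside a closed disc of $S^2$ that contains no endpoint of the diagram; and the S-move, which replaces a crossing-free arc in a disc that meets the diagram in nothing else by another crossing-free arc with the same ends (the disc may contain a pole of $S^2$). Endpoints may not be moved over or under a strand. An oriented $n$-linkoid is an equivalence class of diagrams. A quandle is a set $X$ with an operation $\triangleright$ such that $x\triangleright x=x$, each map $x\mapsto x\triangleright y$ is a bijection, and $(x\triangleright y)\triangleright z=(x\triangleright z)\triangleright(y\triangleright z)$. An $N$-pointed quandle $\mathcal X=(X,x_1,\dots,x_N)$ is a quandle $X$ with $N$ elements $x_1,\dots,x_N\in X$; a homomorphism of $N$-pointed quandles is a quandle homomorphism that sends the $i$-th basepoint to the $i$-th basepoint for each $i$. Write $\hom(\mathcal X,\mathcal Y)$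 for the set of these and $\operatorname{End}(\mathcal X)=\hom(\mathcal X,\mathcal X)$. The fundamental quandle $Q(L)$ of a diagram $L$ is the quandle generated by the arcs of $L$ with one relation for each crossing: if $a$ and $c$ are the incoming and outgoing under-arcs and $b$ is the over-arc, then $c=a\triangleright b$ at a positive crossing and $a=c\triangleright b$ at a negative one. The fundamental pointed quandle is $P(L)=(Q(L),l_1,h_1,\dots,l_n,h_n)$, where $l_i$ and $h_i$ are the generators of the arcs that contain the leg (initial point) and the head (final point) of the $i$-th open component. A directed multigraph is a finite set $V$ with a function $w:V\times V\to\mathbb N\cup\{0\}$; an isomorphism is a bijection of the vertex sets that preserves $w$. For a finite $2n$-pointed quandle $\mathcal X$ and $S\subseteq\operatorname{End}(\mathcal X)$, the pointed quandle coloring quiver $\mathcal Q_{\mathcal X}^S(L)$ is the directed multigraph with vertex set $V=\hom(P(L),\mathcal X)$ and $w(\alpha,\beta)=|\{\varphi\in S\mid \varphi\circ\alpha=\beta\}|$. Theorem. Let $\mathcal X$ be a finite $2n$-pointed quandle and $S\subseteq\operatorname{End}(\mathcal X)$. If $L$ and $L'$ are equivalent $n$-linkoid diagrams, then the directed multigraphs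 $\mathcal Q_{\mathcal X}^S(L)$ and $\mathcal Q_{\mathcal X}^S(L')$ are isomorphic. Consequently, if $F$ is any invariant of directed multigraphs, that is, any assignment that takes equal values on isomorphic directed multigraphs, then $F(\mathcal Q_{\mathcal X}^S(L))=F(\mathcal Q_{\mathcal X}^S(L'))$, so $F$ applied to the quiver is an invariant of oriented $n$-linkoids. -/

import Mathlib

open scoped Quandles ContDiff

/-! # Quandles given by generators and relations

Mathlib's `Quandle` has a left action `y ◃ x`; the operation written `x ▷ y` in knot theory
(the element `x` acted on by `y` from the right) is `y ◃ x`, and `x ▷⁻¹ y` is `y ◃⁻¹ x`. -/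

/-- Formal quandle words in the letters `A`. -/
inductive QuandleWord (A : Type) : Type
  | of : A → QuandleWord A
  | act : QuandleWord A → QuandleWord A → QuandleWord A
  | invAct : QuandleWord A → QuandleWord A → QuandleWord A

/-- The smallest congruence on quandle words that contains `r` and makes the quotient a quandle. -/
inductive QuandleWord.Rel {A : Type} (r : QuandleWord A → QuandleWord A → Prop) :
    QuandleWord A → QuandleWord A → Prop
  | of_rel {x y} : r x y → Rel r x y
  | refl (x) : Rel r x x
  | symm {x y} : Rel r x y → Rel r y x
  | trans {x y z} : Rel r x y → Rel r y z → Rel r x z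
  | act_congr {x x' y y'} : Rel r x x' → Rel r y y' → Rel r (act x y) (act x' y')
  | invAct_congr {x x' y y'} : Rel r x x' → Rel r y y' → Rel r (invAct x y) (invAct x' y')
  | self_distrib (x y z) : Rel r (act x (act y z)) (act (act x y) (act x z))
  | left_inv (x y) : Rel r (invAct x (act x y)) y
  | right_inv (x y) : Rel r (act x (invAct x y)) y
  | fix (x) : Rel r (act x x) x

/-- The congruence `QuandleWord.Rel r` as a setoid. -/
def QuandleWord.setoid {A : Type} (r : QuandleWord A → QuandleWord A → Prop) :
    Setoid (QuandleWord A) where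
  r := QuandleWord.Rel r
  iseqv := ⟨.refl, .symm, .trans⟩

/-- The quandle `⟨ A ∣ r ⟩` with generators `A` and relations `r`. -/
def PresentedQuandle {A : Type} (r : QuandleWord A → QuandleWord A → Prop) : Type :=
  Quotient (QuandleWord.setoid r)

namespace PresentedQuandle

variable {A : Type} {r : QuandleWord A → QuandleWord A → Prop}

/-- The class of a word. -/
def mk (r : QuandleWord A → QuandleWord A → Prop) (x : QuandleWord A) : PresentedQuandle r :=
  Quotient.mk (QuandleWord.setoid r) x

instance : Quandle (PresentedQuandle r) where
  act := Quotient.map₂ QuandleWord.act fun _ _ h _ _ h' => .act_congr h h'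
  invAct := Quotient.map₂ QuandleWord.invAct fun _ _ h _ _ h' => .invAct_congr h h'
  self_distrib := by
    rintro ⟨x⟩ ⟨y⟩ ⟨z⟩
    exact Quotient.sound (.self_distrib x y z)
  left_inv := by
    rintro ⟨x⟩ ⟨y⟩
    exact Quotient.sound (.left_inv x y)
  right_inv := by
    rintro ⟨x⟩ ⟨y⟩
    exact Quotient.sound (.right_inv x y)
  fix := by
    rintro ⟨x⟩
    exact Quotient.sound (.fix x)

/-- The generator given by a letter. -/
def of (r : QuandleWord A → QuandleWord A → Prop) (a : A) : PresentedQuandle r :=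
  mk r (.of a)

/-- A quandle homomorphism out of `⟨ A ∣ r ⟩` is determined by its values on the generators. -/
theorem hom_ext {X : Type*} [Quandle X] {f g : PresentedQuandle r →◃ X}
    (h : ∀ a, f (of r a) = g (of r a)) : f = g := by
  have key : ∀ w : QuandleWord A, f (mk r w) = g (mk r w) := by
    intro w
    induction w with
    | of a => exact h a
    | act x y hx hy =>
      have e : mk r (.act x y) = mk r x ◃ mk r y := rfl
      rw [e, ShelfHom.map_act, ShelfHom.map_act, hx, hy]
    | invAct x y hx hy =>
      have e : mk r x ◃ mk r (.invAct x y) = mk r y :=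
        Quotient.sound (QuandleWord.Rel.right_inv x y)
      have hf := congrArg f e
      have hg := congrArg g e
      rw [ShelfHom.map_act] at hf hg
      rw [hy, ← hg, hx] at hf
      exact (Rack.left_cancel _).1 hf
  refine ShelfHom.ext ?_
  funext q
  induction q using Quotient.inductionOn with
  | h w => exact key w

end PresentedQuandle

/-! # Pointed quandles -/

universe u

/-- An `N`-pointed quandle: a quandle with `N` basepoints. -/
structure PointedQuandle (N : ℕ) : Type (u + 1) where
  carrier : Type u
  [quandle : Quandle carrier]
  base : Fin N → carrier

attribute [instance] PointedQuandle.quandle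

namespace PointedQuandle

universe v w

/-- Pointed quandle homomorphisms: quandle homomorphisms matching the basepoints. -/
def Hom {N : ℕ} (X : PointedQuandle.{u} N) (Y : PointedQuandle.{v} N) : Type (max u v) :=
  {f : X.carrier →◃ Y.carrier // ∀ i, f (X.base i) = Y.base i}

/-- Composition of pointed quandle homomorphisms. -/
def Hom.comp {N : ℕ} {X : PointedQuandle.{u} N} {Y : PointedQuandle.{v} N}
    {Z : PointedQuandle.{w} N} (g : Hom Y Z) (f : Hom X Y) : Hom X Z :=
  ⟨g.1.comp f.1, fun i => by rw [ShelfHom.comp_apply, f.2, g.2]⟩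

/-- Pointed quandle endomorphisms. -/
abbrev End {N : ℕ} (X : PointedQuandle.{u} N) : Type u := Hom X X

end PointedQuandle

/-! # Linkoid diagrams in the 2-sphere -/

/-- Euclidean 3-space, whose unit sphere is `S²`, oriented by the outward normal. -/
abbrev E3 : Type := EuclideanSpace ℝ (Fin 3)

/-- The components of a diagram with `n` open and `m` closed components; the open ones are
enumerated by `Fin n`. -/
abbrev LComp (n m : ℕ) : Type := Fin n ⊕ Fin m

/-- Open components are parametrized by `[0, 1]`, closed ones by `ℝ` with period `1`. -/
def LComp.dom {n m : ℕ} : LComp n m → Set ℝ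
  | Sum.inl _ => Set.Icc 0 1
  | Sum.inr _ => Set.univ

/-- A parameter value on a component. -/
abbrev LPt (n m : ℕ) : Type := LComp n m × ℝ

/-- The parameter value lies in the domain of its component. -/
def LPt.Valid {n m : ℕ} (p : LPt n m) : Prop := p.2 ∈ p.1.dom

/-- `p` and `q` are the same point of the disjoint union of intervals `[0, 1]` and circles
`ℝ / ℤ`. -/
def LPt.Same {n m : ℕ} (p q : LPt n m) : Prop :=
  p.1 = q.1 ∧ (p.2 = q.2 ∨ (p.1.isRight = true ∧ ∃ z : ℤ, q.2 = p.2 + z))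

/-- Position of the point `p` under a family of parametrized curves. -/
def LPt.pos {n m : ℕ} (c : LComp n m → ℝ → E3) (p : LPt n m) : E3 := c p.1 p.2

/-- Velocity at the point `p` of a family of parametrized curves. -/
noncomputable def LPt.vel {n m : ℕ} (c : LComp n m → ℝ → E3) (p : LPt n m) : E3 :=
  derivWithin (c p.1) p.1.dom p.2

/-- `p` and `q` are two different points with the same image. -/
def LPt.Double {n m : ℕ} (c : LComp n m → ℝ → E3) (p q : LPt n m) : Prop :=
  p.Valid ∧ q.Valid ∧ ¬ p.Same q ∧ p.pos c = q.pos c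

/-- An (ordered, oriented) `n`-linkoid diagram in `S²` with `m` closed components: a generic
immersion of `n` intervals and `m` circles in the unit sphere, with finitely many double points,
all of them transverse and away from the endpoints, and with over/under information. -/
structure LinkoidDiagram (n m : ℕ) : Type where
  curve : LComp n m → ℝ → E3
  /-- the points at which the diagram passes under another strand -/
  under : Set (LPt n m)
  norm_eq_one : ∀ k, ∀ t ∈ k.dom, ‖curve k t‖ = 1
  periodic : ∀ j : Fin m, Function.Periodic (curve (Sum.inr j)) 1
  smooth : ∀ k, ContDiffOn ℝ ∞ (curve k) k.dom
  immersion : ∀ k, ∀ t ∈ k.dom, derivWithin (curve k) k.dom t ≠ 0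
  finite_double : {p : LPt n m | p.2 ∈ Set.Icc (0 : ℝ) 1 ∧ ∃ q, LPt.Double curve p q}.Finite
  no_triple : ∀ p q r, LPt.Double curve p q → LPt.Double curve p r → q.Same r
  endpoints : ∀ (i : Fin n) (t : ℝ) (q : LPt n m),
    LPt.Double curve (Sum.inl i, t) q → t ∈ Set.Ioo (0 : ℝ) 1
  transverse : ∀ p q, LPt.Double curve p q → LinearIndependent ℝ ![p.vel curve, q.vel curve]
  under_same : ∀ p q : LPt n m, p.Same q → (p ∈ under ↔ q ∈ under)
  under_double : ∀ p ∈ under, ∃ q, LPt.Double curve p q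
  under_iff : ∀ p q, LPt.Double curve p q → (p ∈ under ↔ q ∉ under)

namespace LinkoidDiagram

variable {n m : ℕ}

/-- `o` and `p` are the two points over a crossing of `L`. -/
def Double (L : LinkoidDiagram n m) (o p : LPt n m) : Prop := LPt.Double L.curve o p

/-- At the double point formed by `o` and `p` the velocities at `o` and `p`, in this order, are a
positively oriented basis of the tangent plane of `S²`; that is, the strand at `p` crosses the
strand at `o` from right to left. If `o` is the over point and `p` is the under point, this says
that the crossing is positive. -/
def RightToLeft (L : LinkoidDiagram n m) (o p : LPt n m) : Prop :=
  0 < Matrix.det (Matrix.of fun i j : Fin 3 =>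
    (![o.pos L.curve, o.vel L.curve, p.vel L.curve] : Fin 3 → E3) i j)

/-! ## Arcs and the fundamental pointed quandle -/

/-- The points of `L` that are not under-crossing points. -/
def NonUnder (L : LinkoidDiagram n m) : Type := {p : LPt n m // p.Valid ∧ p ∉ L.under}

/-- Two points are the same point, or the segment between them has no under-crossing point. -/
def Joined (L : LinkoidDiagram n m) (p q : L.NonUnder) : Prop :=
  p.1.Same q.1 ∨ (p.1.1 = q.1.1 ∧ ∀ s ∈ Set.uIcc p.1.2 q.1.2, (p.1.1, s) ∉ L.under)

/-- The arcs of `L`: the connected components of the diagram cut at its under-crossings. -/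
def Arc (L : LinkoidDiagram n m) : Type := Quot L.Joined

/-- The arc through a point that is not an under-crossing point. -/
def arc (L : LinkoidDiagram n m) (p : L.NonUnder) : L.Arc := Quot.mk _ p

/-- At some crossing of `L`, `a` is the incoming under-arc, `b` is the over-arc and `c` is the
outgoing under-arc; the crossing is positive if `pos` holds and negative otherwise. -/
def IsCrossing (L : LinkoidDiagram n m) (a b c : L.Arc) (pos : Prop) : Prop :=
  ∃ (p o q : L.NonUnder) (u : LPt n m),
    u ∈ L.under ∧ L.Double o.1 u ∧
    p.1.1 = u.1 ∧ p.1.2 < u.2 ∧ (∀ s ∈ Set.Ico p.1.2 u.2, (u.1, s) ∉ L.under) ∧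
    q.1.1 = u.1 ∧ u.2 < q.1.2 ∧ (∀ s ∈ Set.Ioc u.2 q.1.2, (u.1, s) ∉ L.under) ∧
    (pos ↔ L.RightToLeft o.1 u) ∧ L.arc p = a ∧ L.arc o = b ∧ L.arc q = c

/-- The crossing relations, where `a`, `c` are the incoming and outgoing under-arcs and `b` the
over-arc: `c = a ▷ b` at a positive crossing and `a = c ▷ b` at a negative crossing. -/
inductive CrossingRel (L : LinkoidDiagram n m) : QuandleWord L.Arc → QuandleWord L.Arc → Prop
  | positive {a b c : L.Arc} : L.IsCrossing a b c True →
      CrossingRel L (.of c) (.act (.of b) (.of a))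
  | negative {a b c : L.Arc} : L.IsCrossing a b c False →
      CrossingRel L (.of a) (.act (.of b) (.of c))

/-- The fundamental quandle `Q(L)`. -/
abbrev FundamentalQuandle (L : LinkoidDiagram n m) : Type := PresentedQuandle L.CrossingRel

theorem endpoint_not_under (L : LinkoidDiagram n m) (i : Fin n) (t : ℝ) (h : t = 0 ∨ t = 1) :
    (Sum.inl i, t) ∉ L.under := by
  intro hu
  obtain ⟨q, hq⟩ := L.under_double _ hu
  have := L.endpoints i t q hq
  rcases h with rfl | rfl <;> simp at this

/-- The leg of the `i`-th open component. -/
def leg (L : LinkoidDiagram n m) (i : Fin n) : L.NonUnder :=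
  ⟨(Sum.inl i, 0), by simp [LPt.Valid, LComp.dom], L.endpoint_not_under i 0 (Or.inl rfl)⟩

/-- The head of the `i`-th open component. -/
def head (L : LinkoidDiagram n m) (i : Fin n) : L.NonUnder :=
  ⟨(Sum.inl i, 1), by simp [LPt.Valid, LComp.dom], L.endpoint_not_under i 1 (Or.inr rfl)⟩

/-- The fundamental pointed quandle `P(L) = (Q(L), l₁, h₁, …, lₙ, hₙ)`. -/
def fundamentalPointedQuandle (L : LinkoidDiagram n m) : PointedQuandle.{0} (2 * n) where
  carrier := L.FundamentalQuandle
  base j :=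
    let i : Fin n := ⟨j.1 / 2, by have := j.2; omega⟩
    if j.1 % 2 = 0 then PresentedQuandle.of _ (L.arc (L.leg i))
    else PresentedQuandle.of _ (L.arc (L.head i))

/-- A diagram has finitely many arcs. -/
theorem finite_arc (L : LinkoidDiagram n m) : Finite L.Arc := by
  classical
  have hU : {p : LPt n m | p.2 ∈ Set.Icc (0 : ℝ) 1 ∧ p ∈ L.under}.Finite :=
    L.finite_double.subset fun p hp => ⟨hp.1, L.under_double p hp.2⟩
  set U := {p : LPt n m | p.2 ∈ Set.Icc (0 : ℝ) 1 ∧ p ∈ L.under} with hUdef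
  have hrep : ∀ a : L.Arc, ∃ p : L.NonUnder, p.1.2 ∈ Set.Icc (0 : ℝ) 1 ∧ L.arc p = a := by
    rintro ⟨⟨⟨k, t⟩, hv, hu⟩⟩
    cases k with
    | inl i => exact ⟨⟨(Sum.inl i, t), hv, hu⟩, hv, rfl⟩
    | inr j =>
      have hs : LPt.Same ((Sum.inr j, Int.fract t) : LPt n m) (Sum.inr j, t) :=
        ⟨rfl, Or.inr ⟨rfl, ⌊t⌋, (Int.fract_add_floor t).symm⟩⟩
      refine ⟨⟨(Sum.inr j, Int.fract t), trivial, fun h => hu ((L.under_same _ _ hs).1 h)⟩,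
        ⟨Int.fract_nonneg t, (Int.fract_lt_one t).le⟩, ?_⟩
      exact Quot.sound (Or.inl hs)
  choose g hg1 hg2 using hrep
  have hfin : Finite (Set.powerset U) := hU.powerset.to_subtype
  let F : L.Arc → LComp n m × Set.powerset U := fun a =>
    ((g a).1.1, ⟨{p | p ∈ U ∧ p.1 = (g a).1.1 ∧ p.2 < (g a).1.2}, fun p hp => hp.1⟩)
  refine Finite.of_injective F fun a b hab => ?_
  have hk : (g a).1.1 = (g b).1.1 := congrArg (fun z => z.1) hab
  have hS : {p | p ∈ U ∧ p.1 = (g a).1.1 ∧ p.2 < (g a).1.2} =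
      {p | p ∈ U ∧ p.1 = (g b).1.1 ∧ p.2 < (g b).1.2} :=
    congrArg (fun z => z.2.1) hab
  rw [← hg2 a, ← hg2 b]
  refine Quot.sound (Or.inr ⟨hk, fun s hs hsu => ?_⟩)
  have hsI : s ∈ Set.Icc (0 : ℝ) 1 := Set.uIcc_subset_Icc (hg1 a) (hg1 b) hs
  have hmem := Set.ext_iff.1 hS ((g a).1.1, s)
  simp only [Set.mem_ofPred_eq, hUdef, hsI, hk, true_and] at hmem
  rw [Set.mem_uIcc] at hs
  have hsu' : ((g b).1.1, s) ∈ L.under := hk ▸ hsu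
  have ha : s ≠ (g a).1.2 := by
    rintro rfl
    exact (g a).2.2 hsu
  have hb : s ≠ (g b).1.2 := by
    rintro rfl
    exact (g b).2.2 hsu'
  simp only [hsu', true_and] at hmem
  rcases hs with ⟨h1, h2⟩ | ⟨h1, h2⟩
  · exact absurd (hmem.2 (lt_of_le_of_ne h2 hb)) (not_lt.2 h1)
  · exact absurd (hmem.1 (lt_of_le_of_ne h2 ha)) (not_lt.2 h1)

/-! ## Equivalence of diagrams -/

/-- `L'` is obtained from `L` by orientation preserving reparametrizations `h` of the components
and a renumbering `τ` of the closed components. -/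
def Reparam (L L' : LinkoidDiagram n m) : Prop :=
  ∃ (τ : Equiv.Perm (Fin m)) (h : LComp n m → ℝ → ℝ),
    (∀ k, ContDiffOn ℝ ∞ (h k) k.dom) ∧
    (∀ k, ∀ t ∈ k.dom, 0 < derivWithin (h k) k.dom t) ∧
    (∀ i : Fin n, h (Sum.inl i) 0 = 0 ∧ h (Sum.inl i) 1 = 1) ∧
    (∀ (j : Fin m) (t : ℝ), h (Sum.inr j) (t + 1) = h (Sum.inr j) t + 1) ∧
    ∀ k, ∀ t ∈ k.dom, L'.curve k t = L.curve (Sum.map id τ k) (h k t) ∧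
      ((k, t) ∈ L'.under ↔ (Sum.map id τ k, h k t) ∈ L.under)

/-- `L'` is the image of `L` under an isotopy `Φ` of `S²`, that is, a smooth family of
diffeomorphisms of the sphere that starts at the identity. Smooth maps on the sphere are written as
restrictions of smooth maps on the nonzero vectors. -/
def Isotopy (L L' : LinkoidDiagram n m) : Prop :=
  ∃ Φ Ψ : ℝ → E3 → E3,
    ContDiffOn ℝ ∞ (fun p : ℝ × E3 => Φ p.1 p.2) (Set.univ ×ˢ {0}ᶜ) ∧
    ContDiffOn ℝ ∞ (fun p : ℝ × E3 => Ψ p.1 p.2) (Set.univ ×ˢ {0}ᶜ) ∧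
    (∀ s x, ‖x‖ = 1 → ‖Φ s x‖ = 1 ∧ ‖Ψ s x‖ = 1 ∧ Ψ s (Φ s x) = x ∧ Φ s (Ψ s x) = x) ∧
    (∀ x, ‖x‖ = 1 → Φ 0 x = x) ∧
    (∀ k, ∀ t ∈ k.dom, L'.curve k t = Φ 1 (L.curve k t)) ∧
    L'.under = L.under

end LinkoidDiagram

/-- A strand: a closed segment `[a, b]` of a component, which contains no endpoint of the
component and is not a whole circle. -/
structure LStrand (n m : ℕ) : Type where
  comp : LComp n m
  a : ℝ
  b : ℝ
  lt : a < b
  isOpen : comp.isLeft = true → 0 < a ∧ b < 1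
  isClosed : comp.isRight = true → b < a + 1

/-- The points of a strand. -/
def LStrand.points {n m : ℕ} (σ : LStrand n m) : Set (LPt n m) :=
  {p | ∃ t ∈ Set.Icc σ.a σ.b, LPt.Same (σ.comp, t) p}

/-- The point of a strand with parameter `t`. -/
def LStrand.pt {n m : ℕ} (σ : LStrand n m) (t : ℝ) : LPt n m := (σ.comp, t)

namespace LinkoidDiagram

variable {n m : ℕ}

/-- The part of `L` inside the closed disc parametrized by `β` consists of the strands `σ i`; their
interiors run inside the disc and their ends lie on its boundary. -/
def InDisc {r : ℕ} (L : LinkoidDiagram n m) (β : EuclideanSpace ℝ (Fin 2) → E3)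
    (σ : Fin r → LStrand n m) : Prop :=
  (∀ p : LPt n m, p.Valid →
    (p.pos L.curve ∈ β '' Metric.closedBall 0 1 ↔ ∃ i, p ∈ (σ i).points)) ∧
  (∀ i, ∀ t ∈ Set.Ioo (σ i).a (σ i).b, ((σ i).pt t).pos L.curve ∈ β '' Metric.ball 0 1) ∧
  (∀ i, ((σ i).pt (σ i).a).pos L.curve ∈ β '' Metric.sphere 0 1 ∧
    ((σ i).pt (σ i).b).pos L.curve ∈ β '' Metric.sphere 0 1)

/-- `L` and `L'` agree outside a closed disc in `S²`, and both meet the disc in the strands `σ`,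
which have the same ends in `L` and in `L'`. No endpoint of an open component lies in the disc. -/
def LocalChange {r : ℕ} (L L' : LinkoidDiagram n m) (σ : Fin r → LStrand n m) : Prop :=
  (∀ i j, i ≠ j → Disjoint (σ i).points (σ j).points) ∧
  (∃ β : EuclideanSpace ℝ (Fin 2) → E3,
    ContinuousOn β (Metric.closedBall 0 1) ∧ Set.InjOn β (Metric.closedBall 0 1) ∧
    (∀ x ∈ Metric.closedBall (0 : EuclideanSpace ℝ (Fin 2)) 1, ‖β x‖ = 1) ∧
    L.InDisc β σ ∧ L'.InDisc β σ) ∧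
  (∀ p : LPt n m, p.Valid → (∀ i, p ∉ (σ i).points) →
    p.pos L'.curve = p.pos L.curve ∧ (p ∈ L'.under ↔ p ∈ L.under)) ∧
  ∀ i, L'.curve (σ i).comp (σ i).a = L.curve (σ i).comp (σ i).a ∧
    L'.curve (σ i).comp (σ i).b = L.curve (σ i).comp (σ i).b

/-- Every crossing of `L` on the strands `σ` is formed by one of the pairs of points in `C`, in
one of the two orders. -/
def OnlyCrossings {r : ℕ} (L : LinkoidDiagram n m) (σ : Fin r → LStrand n m)
    (C : Set (LPt n m × LPt n m)) : Prop :=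
  ∀ p q, (∃ i, p ∈ (σ i).points) → (∃ i, q ∈ (σ i).points) → L.Double p q →
    ∃ c ∈ C, (p.Same c.1 ∧ q.Same c.2) ∨ (q.Same c.1 ∧ p.Same c.2)

/-- Move of a single arc: a strand without crossings in a disc that is otherwise empty is replaced
by another strand without crossings. The disc may contain the poles of `S²`, so this includes the
S-move, which pulls an arc across a pole. -/
def SMove (L L' : LinkoidDiagram n m) : Prop :=
  ∃ σ : Fin 1 → LStrand n m, LocalChange L L' σ ∧ L.OnlyCrossings σ ∅ ∧ L'.OnlyCrossings σ ∅

/-- First Reidemeister move, creating a kink of any kind: a strand without crossings becomes a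
strand with a single crossing, with itself. -/
def Reidemeister1 (L L' : LinkoidDiagram n m) : Prop :=
  ∃ σ : Fin 1 → LStrand n m, LocalChange L L' σ ∧ L.OnlyCrossings σ ∅ ∧
    ∃ s t : ℝ, (σ 0).a < s ∧ s < t ∧ t < (σ 0).b ∧
      L'.Double ((σ 0).pt s) ((σ 0).pt t) ∧
      L'.OnlyCrossings σ {((σ 0).pt s, (σ 0).pt t)}

/-- Second Reidemeister move, for any orientations of the strands: two disjoint strands without
crossings become a pair of strands that form a bigon, where strand `0` passes over strand `1` at
two crossings of opposite signs. -/
def Reidemeister2 (L L' : LinkoidDiagram n m) : Prop :=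
  ∃ σ : Fin 2 → LStrand n m, LocalChange L L' σ ∧ L.OnlyCrossings σ ∅ ∧
    ∃ s₁ s₂ t₁ t₂ : ℝ,
      s₁ ∈ Set.Ioo (σ 0).a (σ 0).b ∧ s₂ ∈ Set.Ioo (σ 0).a (σ 0).b ∧ s₁ < s₂ ∧
      t₁ ∈ Set.Ioo (σ 1).a (σ 1).b ∧ t₂ ∈ Set.Ioo (σ 1).a (σ 1).b ∧ t₁ ≠ t₂ ∧
      L'.Double ((σ 0).pt s₁) ((σ 1).pt t₁) ∧ L'.Double ((σ 0).pt s₂) ((σ 1).pt t₂) ∧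
      (σ 1).pt t₁ ∈ L'.under ∧ (σ 1).pt t₂ ∈ L'.under ∧
      (L'.RightToLeft ((σ 0).pt s₁) ((σ 1).pt t₁) ↔
        ¬ L'.RightToLeft ((σ 0).pt s₂) ((σ 1).pt t₂)) ∧
      L'.OnlyCrossings σ {((σ 0).pt s₁, (σ 1).pt t₁), ((σ 0).pt s₂, (σ 1).pt t₂)}

/-- The strands `σ 0`, `σ 1`, `σ 2` (top, middle, bottom) of `L` form a triangle: any two of them
cross exactly once, strand `i` meeting strand `j` at its parameter `s i j`, and the strand with
the smaller number is over. The last clause is the side condition of the planar picture: strands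
`j` and `k` cross strand `i` in the same direction (both from right to left or both from left to
right) exactly if their common crossing comes before strand `i` on both of them or after strand `i`
on both of them. -/
def Triangle (L : LinkoidDiagram n m) (σ : Fin 3 → LStrand n m) (s : Fin 3 → Fin 3 → ℝ) : Prop :=
  (∀ i j, i ≠ j → s i j ∈ Set.Ioo (σ i).a (σ i).b ∧
    L.Double ((σ i).pt (s i j)) ((σ j).pt (s j i))) ∧
  (∀ i j, i < j → (σ j).pt (s j i) ∈ L.under) ∧
  L.OnlyCrossings σ {c | ∃ i j, i < j ∧ c = ((σ i).pt (s i j), (σ j).pt (s j i))} ∧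
  ∀ i j k, i ≠ j → i ≠ k → j ≠ k →
    ((L.RightToLeft ((σ i).pt (s i j)) ((σ j).pt (s j i)) ↔
        L.RightToLeft ((σ i).pt (s i k)) ((σ k).pt (s k i))) ↔
      (s j k < s j i ↔ s k j < s k i))

/-- Third Reidemeister move, for any orientations of the strands: a triangle is replaced by the
opposite triangle, in which each strand meets the other two in the reversed order, with the same
crossing signs. -/
def Reidemeister3 (L L' : LinkoidDiagram n m) : Prop :=
  ∃ σ : Fin 3 → LStrand n m, LocalChange L L' σ ∧
    ∃ s s' : Fin 3 → Fin 3 → ℝ, L.Triangle σ s ∧ L'.Triangle σ s' ∧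
      (∀ i j k, i ≠ j → i ≠ k → j ≠ k → (s i j < s i k ↔ s' i k < s' i j)) ∧
      ∀ i j, i < j → (L.RightToLeft ((σ i).pt (s i j)) ((σ j).pt (s j i)) ↔
        L'.RightToLeft ((σ i).pt (s' i j)) ((σ j).pt (s' j i)))

/-- One step of the equivalence of diagrams. -/
inductive Move : LinkoidDiagram n m → LinkoidDiagram n m → Prop
  | reparam {L L'} : Reparam L L' → Move L L'
  | isotopy {L L'} : Isotopy L L' → Move L L'
  | sMove {L L'} : SMove L L' → Move L L'
  | reidemeister1 {L L'} : Reidemeister1 L L' → Move L L'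
  | reidemeister2 {L L'} : Reidemeister2 L L' → Move L L'
  | reidemeister3 {L L'} : Reidemeister3 L L' → Move L L'

/-- Linkoid equivalence `L ∼ L'`: a finite sequence of moves and inverse moves leads from `L`
to `L'`. The moves preserve the number of closed components. -/
def Equivalent (L L' : LinkoidDiagram n m) : Prop := Relation.EqvGen Move L L'

end LinkoidDiagram

/-! # Directed multigraphs and the coloring quiver -/

/-- A directed multigraph: a finite vertex set with a number `w u v` of arcs from `u` to `v`. -/
structure DirectedMultigraph : Type (u + 1) where
  V : Type u
  finite : Finite V
  w : V → V → ℕ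

/-- Isomorphisms of directed multigraphs. -/
structure DirectedMultigraph.Iso (G H : DirectedMultigraph.{u}) : Type u where
  toEquiv : G.V ≃ H.V
  w_eq : ∀ a b, H.w (toEquiv a) (toEquiv b) = G.w a b

/-- A finite pointed quandle has finitely many colorings of a diagram. -/
theorem LinkoidDiagram.finite_colorings {n m : ℕ} (L : LinkoidDiagram n m)
    (X : PointedQuandle.{u} (2 * n)) [Finite X.carrier] :
    Finite (L.fundamentalPointedQuandle.Hom X) := by
  have := L.finite_arc
  let r : QuandleWord L.Arc → QuandleWord L.Arc → Prop := L.CrossingRel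
  let F : L.fundamentalPointedQuandle.Hom X → (L.Arc → X.carrier) := fun f a =>
    f.1 (PresentedQuandle.of r a)
  refine Finite.of_injective F fun f g hfg => Subtype.ext ?_
  exact PresentedQuandle.hom_ext (r := r) fun a => congrFun hfg a

/-- The pointed quandle coloring quiver of `L` with respect to `X` and `S ⊆ End(X)`: its vertices
are the colorings of `L` by `X`, and `w α β` is the number of `φ ∈ S` with `φ ∘ α = β`. -/
noncomputable def coloringQuiver {n m : ℕ} (X : PointedQuandle.{u} (2 * n)) [Finite X.carrier]
    (S : Set X.End) (L : LinkoidDiagram n m) : DirectedMultigraph.{u} where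
  V := L.fundamentalPointedQuandle.Hom X
  finite := L.finite_colorings X
  w α β := Set.ncard {φ : X.End | φ ∈ S ∧ φ.comp α = β}

/-! A homomorphism from `P(L)` to `X` is the same thing as a coloring of the diagram: colors on its
points that are constant along arcs, obey the relation at each crossing and take the basepoints as
values at the legs and heads. By induction on the equivalence, it suffices to treat one move.

For a move from `L` to `L'`, points of the two diagrams are matched by a relation `T` that pairs
every endpoint with itself. If colors at matched points extend in exactly one way, in both
directions, then compatibility along `T` is a bijection between the vertex sets. Applying an
endomorphism `φ` to two compatible colorings keeps them compatible, so the bijection commutes with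
`φ ∘ ·`. Hence `φ ∘ α = β` holds on one side exactly when the corresponding equation holds on the
other, and all weights agree (`LinkoidDiagram.nonempty_coloringQuiver_iso`).

Reparametrizations and isotopies identify the combinatorics of the diagrams (`CombIso`). The point
to check is that crossing signs survive: velocities are rescaled by positive factors in the first
case; in the second, the determinant defining the sign varies continuously during the isotopy and
never vanishes.

The other moves change the diagram inside a disc without endpoints. There the strands have a
transfer map from the colors at their initial ends to those at their final ends (`HasTransfer`). If
the transfer maps before and after agree, an outer coloring extends uniquely over the new strands
(`LocalChange.exists_glue`, `LocalChange.transfers`). The S-move has the identity as transfer map;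
so does a kink, by `x ▷ x = x`, and a bigon, because the two actions are inverse to each other. For
a triangle, the two transfer maps agree by self-distributivity together with the planar side
condition (`triangleMap_not`). -/

/-! # Homomorphisms out of presented quandles -/

/-- The value of a quandle word when its letters are evaluated by `v`. -/
def QuandleWord.value {A : Type} {X : Type*} [Quandle X] (v : A → X) : QuandleWord A → X
  | .of a => v a
  | .act x y => x.value v ◃ y.value v
  | .invAct x y => x.value v ◃⁻¹ y.value v

theorem QuandleWord.Rel.value_eq {A : Type} {X : Type*} [Quandle X]
    {r : QuandleWord A → QuandleWord A → Prop} {v : A → X}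
    (hv : ∀ x y, r x y → x.value v = y.value v) {x y : QuandleWord A} (h : QuandleWord.Rel r x y) :
    x.value v = y.value v := by
  induction h with
  | of_rel h => exact hv _ _ h
  | refl => rfl
  | symm _ ih => exact ih.symm
  | trans _ _ ih ih' => exact ih.trans ih'
  | act_congr _ _ ih ih' => simp only [QuandleWord.value, ih, ih']
  | invAct_congr _ _ ih ih' => simp only [QuandleWord.value, ih, ih']
  | self_distrib => exact Shelf.self_distrib
  | left_inv => exact Rack.left_inv _ _
  | right_inv => exact Rack.right_inv _ _
  | fix => exact Quandle.fix

/-- The homomorphism out of `⟨ A ∣ r ⟩` with given values on the generators. -/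
def PresentedQuandle.lift {A : Type} {X : Type*} [Quandle X]
    {r : QuandleWord A → QuandleWord A → Prop} (v : A → X)
    (hv : ∀ x y, r x y → x.value v = y.value v) : PresentedQuandle r →◃ X where
  toFun := Quotient.lift (QuandleWord.value v) fun _ _ h => QuandleWord.Rel.value_eq hv h
  map_act' := by
    rintro ⟨x⟩ ⟨y⟩
    rfl

/-! # The action of a crossing of either sign -/

open Classical in
/-- The action of `c`, or the inverse action if `P` fails. -/
noncomputable def signedAct {X : Type*} [Quandle X] (P : Prop) (c x : X) : X :=
  if P then c ◃ x else c ◃⁻¹ x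

section signedAct

variable {X : Type*} [Quandle X]

theorem signedAct_congr {P Q : Prop} (h : P ↔ Q) (c x : X) : signedAct P c x = signedAct Q c x := by
  rw [propext h]

theorem signedAct_self (P : Prop) (c : X) : signedAct P c c = c := by
  unfold signedAct
  split_ifs
  · exact Quandle.fix
  · exact Quandle.fix_inv

theorem signedAct_injective (P : Prop) (c : X) : Function.Injective (signedAct P c) := by
  intro x y h
  unfold signedAct at h
  split_ifs at h
  · exact (Rack.left_cancel _).1 h
  · exact (Rack.left_cancel_inv _).1 h

theorem signedAct_signedAct_of_not {P Q : Prop} (h : P ↔ ¬ Q) (c x : X) :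
    signedAct P c (signedAct Q c x) = x := by
  unfold signedAct
  by_cases hQ : Q
  · simp [hQ, h]
  · simp [hQ, h]

theorem signedAct_act (P : Prop) (c x y : X) :
    signedAct P c (x ◃ y) = signedAct P c x ◃ signedAct P c y := by
  unfold signedAct
  split_ifs
  · exact Shelf.self_distrib
  -- The inverse of an automorphism is an automorphism: acting by `c` on both sides reduces the
  -- claim to the direct action.
  · rw [← Rack.left_cancel c, Shelf.self_distrib]
    simp

/-- The signed action of `c` is an automorphism of the signed actions. -/
theorem signedAct_distrib (P Q : Prop) (c x y : X) :
    signedAct P c (signedAct Q x y) = signedAct Q (signedAct P c x) (signedAct P c y) := by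
  by_cases hQ : Q
  · simp only [signedAct, if_pos hQ]
    exact signedAct_act P c x y
  -- For the inverse action of `x`, write `y = x ◃ (x ◃⁻¹ y)`, use the case of the direct action and
  -- cancel.
  · have h := signedAct_act P c x (x ◃⁻¹ y)
    rw [Rack.act_invAct_eq] at h
    have e : ∀ a b : X, signedAct Q a b = a ◃⁻¹ b := fun a b => if_neg hQ
    rw [e, e, h, Rack.invAct_act_eq]

end signedAct

/-! # Points and double points -/

section points

variable {n m : ℕ}

theorem LPt.Same.refl (p : LPt n m) : p.Same p := ⟨rfl, Or.inl rfl⟩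

theorem LPt.Same.symm {p q : LPt n m} (h : p.Same q) : q.Same p := by
  obtain ⟨h1, h2⟩ := h
  refine ⟨h1.symm, ?_⟩
  rcases h2 with h2 | ⟨hr, z, hz⟩
  · exact Or.inl h2.symm
  · exact Or.inr ⟨h1 ▸ hr, -z, by rw [hz]; push_cast; ring⟩

theorem LPt.Same.trans {p q r : LPt n m} (h : p.Same q) (h' : q.Same r) : p.Same r := by
  obtain ⟨h1, h2⟩ := h
  obtain ⟨h1', h2'⟩ := h'
  refine ⟨h1.trans h1', ?_⟩
  rcases h2 with h2 | ⟨hr, z, hz⟩ <;> rcases h2' with h2' | ⟨hr', z', hz'⟩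
  · exact Or.inl (h2.trans h2')
  · exact Or.inr ⟨h1 ▸ hr', z', by rw [hz', h2]⟩
  · exact Or.inr ⟨hr, z, by rw [← h2', hz]⟩
  · exact Or.inr ⟨hr, z + z', by rw [hz', hz]; push_cast; ring⟩

theorem LComp.dom_eq_univ {k : LComp n m} (h : k.isRight = true) : k.dom = Set.univ := by
  cases k with
  | inl i => simp at h
  | inr j => rfl

theorem LComp.convex_dom (k : LComp n m) : Convex ℝ k.dom := by
  cases k with
  | inl i => exact convex_Icc 0 1
  | inr j => exact convex_univ

theorem LComp.uniqueDiffOn_dom (k : LComp n m) : UniqueDiffOn ℝ k.dom := by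
  cases k with
  | inl i => exact uniqueDiffOn_Icc zero_lt_one
  | inr j => exact uniqueDiffOn_univ

theorem LPt.Same.valid {p q : LPt n m} (h : p.Same q) (hp : p.Valid) : q.Valid := by
  obtain ⟨k, s⟩ := p
  obtain ⟨k', t⟩ := q
  obtain ⟨h1, h2⟩ := h
  simp only at h1 h2
  subst h1
  rcases h2 with h2 | ⟨hr, -⟩
  · simpa only [h2] using hp
  · simp [LPt.Valid, LComp.dom_eq_univ hr]

/-- The endpoints of the open components, in the order leg, head, leg, head, … -/
def LPt.endpoint (j : Fin (2 * n)) : LPt n m :=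
  (Sum.inl ⟨j.1 / 2, by have := j.2; omega⟩, if j.1 % 2 = 0 then 0 else 1)

end points

namespace LinkoidDiagram

variable {n m : ℕ} {L L' : LinkoidDiagram n m}

theorem Double.symm {p q : LPt n m} (h : L.Double p q) : L.Double q p :=
  ⟨h.2.1, h.1, fun hs => h.2.2.1 hs.symm, h.2.2.2.symm⟩

theorem Double.over_notMem {o p : LPt n m} (h : L.Double o p) (hp : p ∈ L.under) :
    o ∉ L.under := fun ho => (L.under_iff o p h).1 ho hp

/-- Endpoints are never double points, so both sides of an under-crossing are available inside the
component. -/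
theorem Double.dom_mem_nhds {p q : LPt n m} (h : L.Double p q) : p.1.dom ∈ nhds p.2 := by
  obtain ⟨k, t⟩ := p
  cases k with
  | inl i => exact Icc_mem_nhds (L.endpoints i t q h).1 (L.endpoints i t q h).2
  | inr j => exact Filter.univ_mem

theorem pos_same {p q : LPt n m} (h : p.Same q) : p.pos L.curve = q.pos L.curve := by
  obtain ⟨k, s⟩ := p
  obtain ⟨k', t⟩ := q
  obtain ⟨h1, h2⟩ := h
  simp only at h1 h2
  subst h1
  rcases h2 with h2 | ⟨hr, z, hz⟩
  · rw [h2]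
  · cases k with
    | inl i => simp at hr
    | inr j =>
      have := (L.periodic j).int_mul z s
      simp only [LPt.pos, hz]
      rw [← this, mul_one]

theorem vel_same {p q : LPt n m} (h : p.Same q) : p.vel L.curve = q.vel L.curve := by
  obtain ⟨k, s⟩ := p
  obtain ⟨k', t⟩ := q
  obtain ⟨h1, h2⟩ := h
  simp only at h1 h2
  subst h1
  rcases h2 with h2 | ⟨hr, z, hz⟩
  · rw [h2]
  · cases k with
    | inl i => simp at hr
    | inr j =>
      have hp : (fun x => L.curve (Sum.inr j) (x + (z : ℝ))) = L.curve (Sum.inr j) := by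
        funext x
        have := (L.periodic j).int_mul z x
        rwa [mul_one] at this
      simp only [LPt.vel, LComp.dom, derivWithin_univ, hz]
      rw [← deriv_comp_add_const, hp]

theorem Double.congr {p q p' q' : LPt n m} (h : L.Double p q) (hp : p.Same p') (hq : q.Same q') :
    L.Double p' q' :=
  ⟨hp.valid h.1, hq.valid h.2.1, fun hs => h.2.2.1 ((hp.trans hs).trans hq.symm),
    by rw [← pos_same hp, ← pos_same hq]; exact h.2.2.2⟩

theorem rightToLeft_congr {o p o' p' : LPt n m} (ho : o.Same o') (hp : p.Same p') :
    L.RightToLeft o p ↔ L.RightToLeft o' p' := by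
  unfold RightToLeft
  rw [pos_same ho, vel_same ho, vel_same hp]

/-! ## Colorings -/

variable {X : Type u} [Quandle X]

/-- `f` is a coloring of `L`: it is constant on the arcs and satisfies the crossing relations. Its
values at the under-crossing points do not matter. -/
structure IsColoring (L : LinkoidDiagram n m) (f : LPt n m → X) : Prop where
  same : ∀ p q : LPt n m, p.Same q → p.Valid → p ∉ L.under → f p = f q
  joined : ∀ (k : LComp n m) (s t : ℝ), s ∈ k.dom → t ∈ k.dom →
    (∀ r ∈ Set.uIcc s t, (k, r) ∉ L.under) → f (k, s) = f (k, t)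
  cross : ∀ (k : LComp n m) (o : LPt n m) (t p q : ℝ), L.Double o (k, t) → (k, t) ∈ L.under →
    p ∈ k.dom → q ∈ k.dom → p < t → t < q → (∀ s ∈ Set.Ico p t, (k, s) ∉ L.under) →
    (∀ s ∈ Set.Ioc t q, (k, s) ∉ L.under) →
    f (k, q) = signedAct (L.RightToLeft o (k, t)) (f o) (f (k, p))

end LinkoidDiagram

/-! ### Colorings as homomorphisms from the fundamental pointed quandle -/

namespace LinkoidDiagram

variable {n m : ℕ} {L L' : LinkoidDiagram n m} {X : PointedQuandle.{u} (2 * n)}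

/-- The color of a point in the coloring given by a homomorphism from the fundamental quandle. -/
def colorAt (α : L.fundamentalPointedQuandle.Hom X) (p : L.NonUnder) : X.carrier :=
  α.1 (PresentedQuandle.of L.CrossingRel (L.arc p))

theorem hom_ext_colorAt {α β : L.fundamentalPointedQuandle.Hom X}
    (h : ∀ p, colorAt α p = colorAt β p) : α = β := by
  refine Subtype.ext (PresentedQuandle.hom_ext (r := L.CrossingRel) ?_)
  rintro ⟨p⟩
  exact h p

theorem colorAt_comp (φ : X.End) (α : L.fundamentalPointedQuandle.Hom X) (p : L.NonUnder) :
    colorAt (φ.comp α) p = φ.1 (colorAt α p) := rfl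

theorem colorAt_act (α : L.fundamentalPointedQuandle.Hom X) {p o q : L.NonUnder}
    (h : PresentedQuandle.of L.CrossingRel (L.arc q) =
      PresentedQuandle.of L.CrossingRel (L.arc o) ◃ PresentedQuandle.of L.CrossingRel (L.arc p)) :
    colorAt α q = colorAt α o ◃ colorAt α p :=
  (congrArg α.1 h).trans (ShelfHom.map_act _)

/-- A homomorphism from the fundamental pointed quandle gives a coloring. -/
theorem exists_isColoring (α : L.fundamentalPointedQuandle.Hom X) :
    ∃ f : LPt n m → X.carrier, L.IsColoring f ∧ (∀ j, f (LPt.endpoint j) = X.base j) ∧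
      ∀ p : L.NonUnder, f p.1 = colorAt α p := by
  classical
  obtain ⟨f, hf⟩ : ∃ f : LPt n m → X.carrier, ∀ p : L.NonUnder, f p.1 = colorAt α p := by
    have key : ∀ p : LPt n m, ∃ x : X.carrier, ∀ h : p.Valid ∧ p ∉ L.under,
        x = colorAt α ⟨p, h⟩ := by
      rintro ⟨k, t⟩
      by_cases h : LPt.Valid (k, t) ∧ (k, t) ∉ L.under
      · exact ⟨colorAt α ⟨_, h⟩, fun _ => rfl⟩
      -- Under-crossing points and parameters outside the domain need some default color. One exists
      -- because a component always provides a point that is not an under-crossing: a leg, or the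
      -- over point above an under-crossing.
      · obtain ⟨q⟩ : Nonempty L.NonUnder := by
          cases k with
          | inl i => exact ⟨L.leg i⟩
          | inr j =>
            by_cases hu : (Sum.inr j, t) ∈ L.under
            · obtain ⟨q, hq⟩ := L.under_double _ hu
              exact ⟨⟨q, hq.2.1, Double.over_notMem (Double.symm hq) hu⟩⟩
            · exact ⟨⟨(Sum.inr j, t), Set.mem_univ t, hu⟩⟩
        exact ⟨colorAt α q, fun h' => absurd h' h⟩
    choose f hf using key
    exact ⟨f, fun p => hf p.1 p.2⟩
  refine ⟨f, ⟨?_, ?_, ?_⟩, ?_, hf⟩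
  · intro p q hs hp hu
    have hq : q ∉ L.under := fun h => hu ((L.under_same p q hs).2 h)
    rw [hf ⟨p, hp, hu⟩, hf ⟨q, hs.valid hp, hq⟩]
    unfold colorAt
    have : L.arc ⟨p, hp, hu⟩ = L.arc ⟨q, hs.valid hp, hq⟩ := Quot.sound (Or.inl hs)
    rw [this]
  · intro k s t hs ht h
    have h1 := h s Set.left_mem_uIcc
    have h2 := h t Set.right_mem_uIcc
    rw [hf ⟨(k, s), hs, h1⟩, hf ⟨(k, t), ht, h2⟩]
    unfold colorAt
    have : L.arc ⟨(k, s), hs, h1⟩ = L.arc ⟨(k, t), ht, h2⟩ := Quot.sound (Or.inr ⟨rfl, h⟩)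
    rw [this]
  · intro k o t p q hd hu hp hq hpt htq hclp hclq
    have h1 := hclp p ⟨le_rfl, hpt⟩
    have h2 := hclq q ⟨htq, le_rfl⟩
    have h3 := Double.over_notMem hd hu
    rw [hf ⟨(k, p), hp, h1⟩, hf ⟨(k, q), hq, h2⟩, hf ⟨o, hd.1, h3⟩]
    by_cases hpos : L.RightToLeft o (k, t)
    · have hc : L.IsCrossing (L.arc ⟨(k, p), hp, h1⟩) (L.arc ⟨o, hd.1, h3⟩)
          (L.arc ⟨(k, q), hq, h2⟩) True :=
        ⟨_, _, _, (k, t), hu, hd, rfl, hpt, hclp, rfl, htq, hclq, by simp [hpos], rfl, rfl, rfl⟩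
      have e : PresentedQuandle.of L.CrossingRel (L.arc ⟨(k, q), hq, h2⟩) =
          PresentedQuandle.of L.CrossingRel (L.arc ⟨o, hd.1, h3⟩) ◃
            PresentedQuandle.of L.CrossingRel (L.arc ⟨(k, p), hp, h1⟩) :=
        Quotient.sound (QuandleWord.Rel.of_rel (CrossingRel.positive hc))
      rw [signedAct, if_pos hpos]
      exact colorAt_act α e
    · have hc : L.IsCrossing (L.arc ⟨(k, p), hp, h1⟩) (L.arc ⟨o, hd.1, h3⟩)
          (L.arc ⟨(k, q), hq, h2⟩) False :=
        ⟨_, _, _, (k, t), hu, hd, rfl, hpt, hclp, rfl, htq, hclq, by simp [hpos], rfl, rfl, rfl⟩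
      have e : PresentedQuandle.of L.CrossingRel (L.arc ⟨(k, p), hp, h1⟩) =
          PresentedQuandle.of L.CrossingRel (L.arc ⟨o, hd.1, h3⟩) ◃
            PresentedQuandle.of L.CrossingRel (L.arc ⟨(k, q), hq, h2⟩) :=
        Quotient.sound (QuandleWord.Rel.of_rel (CrossingRel.negative hc))
      rw [signedAct, if_neg hpos, colorAt_act α e, Rack.invAct_act_eq]
  · intro j
    have hb := α.2 j
    rw [← hb]
    unfold LPt.endpoint fundamentalPointedQuandle
    simp only
    split_ifs
    · exact hf (L.leg _)
    · exact hf (L.head _)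

/-- A coloring gives a homomorphism from the fundamental pointed quandle. -/
theorem IsColoring.exists_hom {f : LPt n m → X.carrier} (hf : L.IsColoring f)
    (hb : ∀ j, f (LPt.endpoint j) = X.base j) :
    ∃ α : L.fundamentalPointedQuandle.Hom X, ∀ p : L.NonUnder, colorAt α p = f p.1 := by
  let v : L.Arc → X.carrier := Quot.lift (fun p => f p.1) (by
    rintro ⟨⟨k, s⟩, hp⟩ ⟨⟨k', t⟩, hq⟩ (h | ⟨h, h'⟩)
    · exact hf.same _ _ h hp.1 hp.2
    · simp only at h h'
      subst h
      exact hf.joined k s t hp.1 hq.1 h')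
  have hcross : ∀ a b c P, L.IsCrossing a b c P → v c = signedAct P (v b) (v a) := by
    rintro a b c P ⟨⟨⟨k, p⟩, hp⟩, o, ⟨⟨k', q⟩, hq⟩, ⟨k'', t⟩, hu, hd, h1, h2, h3, h4, h5, h6, h7,
      rfl, rfl, rfl⟩
    simp only at h1 h2 h3 h4 h5 h6
    subst h1 h4
    change f (k', q) = signedAct P (f o.1) (f (k', p))
    rw [signedAct_congr h7]
    exact hf.cross _ _ _ _ _ hd hu hp.1 hq.1 h2 h5 h3 h6
  have hrel : ∀ x y, L.CrossingRel x y → x.value v = y.value v := by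
    rintro _ _ (h | h)
    · have := hcross _ _ _ _ h
      simpa [signedAct, QuandleWord.value] using this
    · have := hcross _ _ _ _ h
      simp only [signedAct, if_false] at this
      simp [QuandleWord.value, this]
  refine ⟨⟨PresentedQuandle.lift v hrel, fun j => ?_⟩, fun p => rfl⟩
  rw [← hb j]
  unfold LPt.endpoint fundamentalPointedQuandle
  simp only
  split_ifs <;> rfl

/-! ## Isomorphisms of coloring quivers -/

/-- Two colorings are compatible along a relation of points. -/
def Compatible (T : LPt n m → LPt n m → Prop) (α : L.fundamentalPointedQuandle.Hom X)
    (α' : L'.fundamentalPointedQuandle.Hom X) : Prop :=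
  ∀ (p : L.NonUnder) (p' : L'.NonUnder), T p.1 p'.1 → colorAt α p = colorAt α' p'

/-- Every coloring of `L` gives one of `L'` with the same colors at points related by `T`, and the
colors at these points determine a coloring of `L'`. -/
structure Transfers (X : Type u) [Quandle X] (T : LPt n m → LPt n m → Prop)
    (L L' : LinkoidDiagram n m) : Prop where
  exists_coloring : ∀ f : LPt n m → X, L.IsColoring f → ∃ f' : LPt n m → X, L'.IsColoring f' ∧
    ∀ p p', T p p' → p.Valid → p'.Valid → p ∉ L.under → p' ∉ L'.under → f p = f' p'
  unique : ∀ f g : LPt n m → X, L'.IsColoring f → L'.IsColoring g →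
    (∀ p p', T p p' → p.Valid → p'.Valid → p ∉ L.under → p' ∉ L'.under → f p' = g p') →
    ∀ p', p'.Valid → p' ∉ L'.under → f p' = g p'

theorem endpoint_valid_notMem (L : LinkoidDiagram n m) (j : Fin (2 * n)) :
    (LPt.endpoint j : LPt n m).Valid ∧ (LPt.endpoint j : LPt n m) ∉ L.under := by
  unfold LPt.endpoint
  split_ifs
  · exact (L.leg _).2
  · exact (L.head _).2

/-- Since each endpoint is matched with itself, the transferred coloring has the right values at the
legs and heads and therefore defines a pointed homomorphism. -/
theorem Transfers.existsUnique {T : LPt n m → LPt n m → Prop}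
    (h : Transfers X.carrier T L L')
    (hT : ∀ j, T (LPt.endpoint j) (LPt.endpoint j)) (α : L.fundamentalPointedQuandle.Hom X) :
    ∃! α' : L'.fundamentalPointedQuandle.Hom X, Compatible T α α' := by
  obtain ⟨f, hf, hb, hα⟩ := exists_isColoring α
  obtain ⟨f', hf', hff'⟩ := h.exists_coloring f hf
  have hb' : ∀ j, f' (LPt.endpoint j) = X.base j := fun j => by
    rw [← hb j]
    exact (hff' _ _ (hT j) (L.endpoint_valid_notMem j).1 (L.endpoint_valid_notMem j).1
      (L.endpoint_valid_notMem j).2 (L'.endpoint_valid_notMem j).2).symm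
  obtain ⟨α', hα'⟩ := hf'.exists_hom hb'
  refine ⟨α', fun p p' hp => ?_, fun β hβ => hom_ext_colorAt fun p => ?_⟩
  · rw [hα', ← hα]
    exact hff' _ _ hp p.2.1 p'.2.1 p.2.2 p'.2.2
  · obtain ⟨g, hg, -, hβg⟩ := exists_isColoring β
    rw [hα', ← hβg]
    refine h.unique g f' hg hf' (fun q q' hq v v' u u' => ?_) p.1 p.2.1 p.2.2
    rw [← hff' q q' hq v v' u u', hα ⟨q, v, u⟩, hβg ⟨q', v', u'⟩]
    exact (hβ ⟨q, v, u⟩ ⟨q', v', u'⟩ hq).symm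

/-- Unique compatible partners in both directions give mutually inverse maps of colorings.
Equivariance under `End(X)` also comes from uniqueness, and it makes the sets of `φ` counted by the
two weights equal, not merely equinumerous. -/
theorem nonempty_coloringQuiver_iso [Finite X.carrier] (S : Set X.End)
    {T : LPt n m → LPt n m → Prop} (hT : ∀ j, T (LPt.endpoint j) (LPt.endpoint j))
    (h : Transfers X.carrier T L L') (h' : Transfers X.carrier (flip T) L' L) :
    Nonempty ((coloringQuiver X S L).Iso (coloringQuiver X S L')) := by
  have e := h.existsUnique hT
  have e' : ∀ α' : L'.fundamentalPointedQuandle.Hom X,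
      ∃! α : L.fundamentalPointedQuandle.Hom X, Compatible T α α' := by
    intro α'
    obtain ⟨α, hα, hu⟩ := h'.existsUnique (T := flip T) hT α'
    exact ⟨α, fun p p' hp => (hα p' p hp).symm, fun β hβ => hu β fun p p' hp => (hβ p' p hp).symm⟩
  choose F hF hFu using e
  choose G hG hGu using e'
  have hcomp : ∀ (φ : X.End) (α : L.fundamentalPointedQuandle.Hom X), F (φ.comp α) = φ.comp (F α) :=
    fun φ α => ((hFu (φ.comp α)) (φ.comp (F α)) fun p p' hp => by
      rw [colorAt_comp, colorAt_comp, hF α p p' hp]).symm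
  have hGF : Function.LeftInverse G F := fun α => (hGu (F α) α (hF α)).symm
  have hFG : Function.RightInverse G F := fun α => (hFu (G α) α (hG α)).symm
  refine ⟨⟨⟨F, G, hGF, hFG⟩, fun (α β : L.fundamentalPointedQuandle.Hom X) => ?_⟩⟩
  change Set.ncard {φ : X.End | φ ∈ S ∧ φ.comp (F α) = F β} =
    Set.ncard {φ : X.End | φ ∈ S ∧ φ.comp α = β}
  congr 1
  ext φ
  change (φ ∈ S ∧ φ.comp (F α) = F β) ↔ (φ ∈ S ∧ φ.comp α = β)
  rw [← hcomp, hGF.injective.eq_iff]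

end LinkoidDiagram

/-! # Diagrams with the same combinatorics -/

namespace LinkoidDiagram

variable {n m : ℕ} {L L' : LinkoidDiagram n m}

/-- The point maps `(k, t) ↦ (e k, h k t)` and `(k, t) ↦ (e' k, h' k t)` are mutually inverse and
identify `L'` with `L` as oriented combinatorial diagrams. -/
structure CombIso (L L' : LinkoidDiagram n m) (e e' : LComp n m → LComp n m)
    (h h' : LComp n m → ℝ → ℝ) : Prop where
  left_inv_comp : ∀ k, e' (e k) = k
  right_inv_comp : ∀ k, e (e' k) = k
  maps : ∀ k, ∀ t ∈ k.dom, h k t ∈ (e k).dom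
  maps' : ∀ k, ∀ t ∈ k.dom, h' k t ∈ (e' k).dom
  left_inv : ∀ k, ∀ t ∈ k.dom, h' (e k) (h k t) = t
  right_inv : ∀ k, ∀ t ∈ k.dom, h (e' k) (h' k t) = t
  mono : ∀ k, StrictMonoOn (h k) k.dom
  same_iff : ∀ p q : LPt n m, p.Valid → q.Valid →
    (p.Same q ↔ LPt.Same (e p.1, h p.1 p.2) (e q.1, h q.1 q.2))
  double_iff : ∀ p q : LPt n m, p.Valid → q.Valid →
    (L'.Double p q ↔ L.Double (e p.1, h p.1 p.2) (e q.1, h q.1 q.2))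
  under_iff : ∀ p : LPt n m, p.Valid → (p ∈ L'.under ↔ (e p.1, h p.1 p.2) ∈ L.under)
  rightToLeft_iff : ∀ p q : LPt n m, L'.Double p q →
    (L'.RightToLeft p q ↔ L.RightToLeft (e p.1, h p.1 p.2) (e q.1, h q.1 q.2))

namespace CombIso

variable {e e' : LComp n m → LComp n m} {h h' : LComp n m → ℝ → ℝ}

theorem apply_apply (H : CombIso L L' e e' h h') {p : LPt n m} (hp : p.Valid) :
    ((e (e' p.1), h (e' p.1) (h' p.1 p.2)) : LPt n m) = p :=
  Prod.ext (H.right_inv_comp p.1) (H.right_inv p.1 p.2 hp)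

theorem valid' (H : CombIso L L' e e' h h') {p : LPt n m} (hp : p.Valid) :
    LPt.Valid (e' p.1, h' p.1 p.2) := H.maps' p.1 p.2 hp

theorem symm (H : CombIso L L' e e' h h') : CombIso L' L e' e h' h where
  left_inv_comp := H.right_inv_comp
  right_inv_comp := H.left_inv_comp
  maps := H.maps'
  maps' := H.maps
  left_inv := H.right_inv
  right_inv := H.left_inv
  mono k s hs t ht hst := by
    refine ((H.mono (e' k)).lt_iff_lt (H.maps' k s hs) (H.maps' k t ht)).1 ?_
    rwa [H.right_inv k s hs, H.right_inv k t ht]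
  same_iff p q hp hq := by
    rw [H.same_iff _ _ (H.valid' hp) (H.valid' hq), H.apply_apply hp, H.apply_apply hq]
  double_iff p q hp hq := by
    rw [H.double_iff _ _ (H.valid' hp) (H.valid' hq), H.apply_apply hp, H.apply_apply hq]
  under_iff p hp := by
    rw [H.under_iff _ (H.valid' hp), H.apply_apply hp]
  rightToLeft_iff p q hd := by
    have hd' := hd
    rw [← H.apply_apply hd.1, ← H.apply_apply hd.2.1,
      ← H.double_iff _ _ (H.valid' hd.1) (H.valid' hd.2.1)] at hd'
    rw [H.rightToLeft_iff _ _ hd', H.apply_apply hd.1, H.apply_apply hd.2.1]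

/-- A coloring is pulled back along the point map. The conditions on intervals free of
under-crossings carry over because `h k` is increasing and maps an interval onto the interval
between the images of its ends. -/
theorem isColoring {X : Type u} [Quandle X] (H : CombIso L L' e e' h h') {f : LPt n m → X}
    (hf : L.IsColoring f) : L'.IsColoring fun p => f (e p.1, h p.1 p.2) := by
  have clear : ∀ k s t r, s ∈ k.dom → t ∈ k.dom → r ∈ Set.Icc (h k s) (h k t) →
      ∃ r' ∈ Set.Icc s t, r' ∈ k.dom ∧ h k r' = r := by
    intro k s t r hs ht hr
    have hr' : r ∈ (e k).dom := (e k).convex_dom.ordConnected.out (H.maps k s hs) (H.maps k t ht) hr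
    have hk : h' (e k) r ∈ k.dom := by
      have := H.maps' (e k) r hr'
      rwa [H.left_inv_comp] at this
    have hhr : h k (h' (e k) r) = r := by
      have := H.right_inv (e k) r hr'
      rwa [H.left_inv_comp] at this
    refine ⟨h' (e k) r, ⟨?_, ?_⟩, hk, hhr⟩
    · rw [← (H.mono k).le_iff_le hs hk, hhr]
      exact hr.1
    · rw [← (H.mono k).le_iff_le hk ht, hhr]
      exact hr.2
  refine ⟨?_, ?_, ?_⟩
  · intro p q hs hp hu
    refine hf.same _ _ ((H.same_iff p q hp (hs.valid hp)).1 hs) (H.maps _ _ hp) ?_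
    rwa [← H.under_iff p hp]
  · intro k s t hs ht hcl
    refine hf.joined _ _ _ (H.maps _ _ hs) (H.maps _ _ ht) fun r hr => ?_
    rcases le_total s t with hst | hst
    · rw [Set.uIcc_of_le (((H.mono k).le_iff_le hs ht).2 hst)] at hr
      obtain ⟨r', hr', hd, rfl⟩ := clear k s t r hs ht hr
      rw [← H.under_iff (k, r') hd]
      exact hcl r' (Set.Icc_subset_uIcc hr')
    · rw [Set.uIcc_of_ge (((H.mono k).le_iff_le ht hs).2 hst)] at hr
      obtain ⟨r', hr', hd, rfl⟩ := clear k t s r ht hs hr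
      rw [← H.under_iff (k, r') hd]
      exact hcl r' (Set.Icc_subset_uIcc' hr')
  · intro k o t p q hd hu hp hq hpt htq hclp hclq
    rw [signedAct_congr (H.rightToLeft_iff _ _ hd)]
    have ht : t ∈ k.dom := hd.2.1
    refine hf.cross (e k) _ _ _ _ ((H.double_iff _ _ hd.1 hd.2.1).1 hd)
      ((H.under_iff _ hd.2.1).1 hu) (H.maps _ _ hp) (H.maps _ _ hq) (H.mono k hp ht hpt)
      (H.mono k ht hq htq) (fun s hs => ?_) fun s hs => ?_
    · obtain ⟨r', hr', hrd, rfl⟩ := clear k p t s hp ht ⟨hs.1, hs.2.le⟩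
      rw [← H.under_iff (k, r') hrd]
      exact hclp r' ⟨hr'.1, ((H.mono k).lt_iff_lt hrd ht).1 hs.2⟩
    · obtain ⟨r', hr', hrd, rfl⟩ := clear k t q s ht hq ⟨hs.1.le, hs.2⟩
      rw [← H.under_iff (k, r') hrd]
      exact hclq r' ⟨((H.mono k).lt_iff_lt ht hrd).1 hs.1, hr'.2⟩

/-- The relation has to be the graph of the point map on valid points only: outside the domains
nothing is known about `h'`, and the flipped graph of the inverse map is needed too. -/
theorem transfers {X : Type u} [Quandle X] (H : CombIso L L' e e' h h')
    (T : LPt n m → LPt n m → Prop)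
    (hT : ∀ p p', p.Valid → p'.Valid → (T p p' ↔ p = (e p'.1, h p'.1 p'.2))) :
    Transfers X T L L' where
  exists_coloring f hf := ⟨_, H.isColoring hf, fun p p' hp v v' _ _ => by
    simp only [← (hT p p' v v').1 hp]⟩
  unique f g _ _ hfg p' hp' hu' := by
    have hv := H.symm.valid' hp'
    exact hfg _ p' ((hT _ _ hv hp').2 rfl) hv hp' (fun hu => hu' ((H.under_iff p' hp').2 hu)) hu'

theorem nonempty_coloringQuiver_iso {X : PointedQuandle.{u} (2 * n)} [Finite X.carrier]
    (S : Set X.End) (H : CombIso L L' e e' h h')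
    (hend : ∀ j : Fin (2 * n), ((e (LPt.endpoint j : LPt n m).1,
      h (LPt.endpoint j : LPt n m).1 (LPt.endpoint j : LPt n m).2) : LPt n m) = LPt.endpoint j) :
    Nonempty ((coloringQuiver X S L).Iso (coloringQuiver X S L')) := by
  refine LinkoidDiagram.nonempty_coloringQuiver_iso S
    (T := fun p p' => p = (e p'.1, h p'.1 p'.2)) (fun j => (hend j).symm)
    (H.transfers _ fun _ _ _ _ => Iff.rfl) (H.symm.transfers _ fun p p' hp hp' => ?_)
  constructor
  · intro (hpp : p' = _)
    have := H.symm.apply_apply hp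
    rw [← this, hpp]
  · rintro rfl
    exact (H.apply_apply hp').symm

end CombIso

/-! ## Reparametrizations -/

theorem hasDerivWithinAt_curve (L : LinkoidDiagram n m) {p : LPt n m} (hp : p.Valid) :
    HasDerivWithinAt (L.curve p.1) (p.vel L.curve) p.1.dom p.2 :=
  ((L.smooth p.1).differentiableOn (by simp) p.2 hp).hasDerivWithinAt

theorem det_smul_smul (x v w : E3) (a b : ℝ) :
    Matrix.det (Matrix.of fun i j : Fin 3 => (![x, a • v, b • w] : Fin 3 → E3) i j) =
      a * b * Matrix.det (Matrix.of fun i j : Fin 3 => (![x, v, w] : Fin 3 → E3) i j) := by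
  simp [Matrix.det_fin_three]
  ring

/-- A positive derivative makes each `h k` strictly increasing, and the intermediate value theorem
makes it onto. By the chain rule, each velocity is multiplied by a positive number, which preserves
the sign of the determinant at a crossing. -/
theorem exists_combIso_of_reparam (hR : Reparam L L') :
    ∃ e e' h h', CombIso L L' e e' h h' ∧
      ∀ j : Fin (2 * n), ((e (LPt.endpoint j : LPt n m).1,
        h (LPt.endpoint j : LPt n m).1 (LPt.endpoint j : LPt n m).2) : LPt n m) =
          LPt.endpoint j := by
  obtain ⟨τ, h, hsm, hder, hend, hper, hcu⟩ := hR
  let e : LComp n m → LComp n m := Sum.map id τ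
  let e' : LComp n m → LComp n m := Sum.map id τ.symm
  have he : ∀ k, e' (e k) = k := by rintro (i | j) <;> simp [e, e']
  have he' : ∀ k, e (e' k) = k := by rintro (i | j) <;> simp [e, e']
  have hdom : ∀ k, (e k).dom = k.dom := by rintro (i | j) <;> rfl
  have hdom' : ∀ k, (e' k).dom = k.dom := by rintro (i | j) <;> rfl
  have hright : ∀ k, (e k).isRight = k.isRight := by rintro (i | j) <;> rfl
  have mono : ∀ k, StrictMonoOn (h k) k.dom := fun k =>
    strictMonoOn_of_deriv_pos k.convex_dom (hsm k).continuousOn fun x hx => by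
      rw [← derivWithin_of_mem_nhds (mem_interior_iff_mem_nhds.1 hx)]
      exact hder k x (interior_subset hx)
  -- The displacement `h x - x` has period `1`, so `h` commutes with all integer translations.
  have hint : ∀ (j : Fin m) (t : ℝ) (z : ℤ), h (Sum.inr j) (t + z) = h (Sum.inr j) t + z := by
    intro j t z
    have hp : Function.Periodic (fun x => h (Sum.inr j) x - x) 1 := fun x => by
      simp only [hper]
      ring
    have := hp.int_mul z t
    simp only [mul_one] at this
    linarith
  have image : ∀ k, h k '' k.dom = k.dom := by
    rintro (i | j)
    · refine Set.Subset.antisymm ?_ ?_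
      · rintro _ ⟨t, ht, rfl⟩
        have ht' : t ∈ Set.Icc (0 : ℝ) 1 := ht
        have m0 := (mono (Sum.inl i)).monotoneOn (Set.left_mem_Icc.2 zero_le_one) ht ht'.1
        have m1 := (mono (Sum.inl i)).monotoneOn ht (Set.right_mem_Icc.2 zero_le_one) ht'.2
        rw [(hend i).1] at m0
        rw [(hend i).2] at m1
        exact ⟨m0, m1⟩
      · have := intermediate_value_Icc zero_le_one (hsm (Sum.inl i)).continuousOn
        rwa [(hend i).1, (hend i).2] at this
    · refine Set.Subset.antisymm (Set.subset_univ _) fun y _ => ?_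
      have hc : ContinuousOn (h (Sum.inr j)) Set.univ := (hsm (Sum.inr j)).continuousOn
      -- By the translation rule, the values at `-N` and `N` are `h 0 - N` and `h 0 + N`, so this
      -- choice of `N` encloses `y`.
      obtain ⟨N, hN⟩ := exists_nat_ge |y - h (Sum.inr j) 0|
      have h1 := hint j 0 N
      have h2 := hint j 0 (-N)
      push_cast at h1 h2
      rw [zero_add] at h1 h2
      have hy : y ∈ Set.Icc (h (Sum.inr j) (-N)) (h (Sum.inr j) N) := by
        rw [h1, h2]
        have := abs_le.1 hN
        constructor <;> linarith [this.1, this.2]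
      have hle : (-N : ℝ) ≤ N := by
        have : (0 : ℝ) ≤ N := Nat.cast_nonneg N
        linarith
      obtain ⟨t, -, ht⟩ := intermediate_value_Icc hle (hc.mono (Set.subset_univ _)) hy
      exact ⟨t, Set.mem_univ t, ht⟩
  let h' : LComp n m → ℝ → ℝ := fun k => Function.invFunOn (h (e' k)) (e' k).dom
  have hposq : ∀ p : LPt n m, p.Valid →
      p.pos L'.curve = LPt.pos L.curve (e p.1, h p.1 p.2) := fun p hp => (hcu p.1 p.2 hp).1
  have hvel : ∀ p : LPt n m, p.Valid →
      p.vel L'.curve = derivWithin (h p.1) p.1.dom p.2 •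
        LPt.vel L.curve (e p.1, h p.1 p.2) := by
    rintro ⟨k, t⟩ hp
    have hm : h k t ∈ (e k).dom := by
      rw [hdom, ← image]
      exact Set.mem_image_of_mem _ hp
    have hmaps : Set.MapsTo (h k) k.dom (e k).dom := fun s hs => by
      rw [hdom, ← image]
      exact Set.mem_image_of_mem _ hs
    have hd1 := L.hasDerivWithinAt_curve (p := (e k, h k t)) hm
    have hd2 : HasDerivWithinAt (h k) (derivWithin (h k) k.dom t) k.dom t :=
      ((hsm k).differentiableOn (by simp) t hp).hasDerivWithinAt
    have hd := HasDerivWithinAt.scomp t hd1 hd2 hmaps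
    have hd' : HasDerivWithinAt (L'.curve k) _ k.dom t :=
      hd.congr (fun s hs => (hcu k s hs).1) (hcu k t hp).1
    exact hd'.derivWithin (k.uniqueDiffOn_dom t hp)
  have hsame : ∀ p q : LPt n m, p.Valid → q.Valid →
      (p.Same q ↔ LPt.Same (e p.1, h p.1 p.2) (e q.1, h q.1 q.2)) := by
    rintro ⟨k, s⟩ ⟨k', t⟩ hp hq
    constructor
    · rintro ⟨h1, h2⟩
      simp only at h1 h2
      subst h1
      refine ⟨rfl, ?_⟩
      rcases h2 with rfl | ⟨hr, z, rfl⟩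
      · exact Or.inl rfl
      · refine Or.inr ⟨by rw [← hr]; exact hright k, z, ?_⟩
        cases k with
        | inl i => simp at hr
        | inr j => exact hint j s z
    · rintro ⟨h1, h2⟩
      have h1' : k = k' := by
        have := congrArg e' h1
        simpa only [he] using this
      subst h1'
      refine ⟨rfl, ?_⟩
      rcases h2 with h2 | ⟨hr, z, h2⟩
      · exact Or.inl ((mono k).injOn hp hq h2)
      · rw [hright] at hr
        refine Or.inr ⟨hr, z, ?_⟩
        cases k with
        | inl i => simp at hr
        | inr j =>
          simp only at h2
          rw [← hint j s z] at h2
          exact (mono (Sum.inr j)).injOn (Set.mem_univ _) (Set.mem_univ _) h2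
  have maps : ∀ k, ∀ t ∈ k.dom, h k t ∈ (e k).dom := fun k t ht => by
    rw [hdom, ← image]
    exact Set.mem_image_of_mem _ ht
  have himg : ∀ k, ∀ t ∈ k.dom, t ∈ h (e' k) '' (e' k).dom := fun k t ht => by
    rw [image, hdom']
    exact ht
  refine ⟨e, e', h, h', ⟨he, he', maps, ?_, ?_, ?_, mono, hsame, ?_, ?_, ?_⟩, ?_⟩
  · exact fun k t ht => Function.invFunOn_mem (himg k t ht)
  · intro k t ht
    change Function.invFunOn (h (e' (e k))) (e' (e k)).dom (h k t) = t
    rw [he]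
    exact (mono k).injOn.leftInvOn_invFunOn ht
  · exact fun k t ht => Function.invFunOn_eq (himg k t ht)
  · intro p q hp hq
    unfold Double LPt.Double
    rw [← hsame p q hp hq, ← hposq p hp, ← hposq q hq]
    have := maps p.1 p.2 hp
    have := maps q.1 q.2 hq
    simp [LPt.Valid] at *
    tauto
  · exact fun p hp => (hcu p.1 p.2 hp).2
  · intro p q hd
    unfold RightToLeft
    rw [hposq p hd.1, hvel p hd.1, hvel q hd.2.1, det_smul_smul]
    exact mul_pos_iff_of_pos_left (mul_pos (hder _ _ hd.1) (hder _ _ hd.2.1))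
  · intro j
    unfold LPt.endpoint
    refine Prod.ext rfl ?_
    simp only
    split_ifs
    · exact (hend _).1
    · exact (hend _).2

/-! ## Isotopies -/

theorem det_ne_zero_of_forall {x v w : E3}
    (H : ∀ a b c : ℝ, a • x + b • v + c • w = 0 → a = 0 ∧ b = 0 ∧ c = 0) :
    Matrix.det (Matrix.of fun i j : Fin 3 => (![x, v, w] : Fin 3 → E3) i j) ≠ 0 := by
  intro h0
  obtain ⟨y, hy, hy'⟩ := Matrix.exists_vecMul_eq_zero_iff.2 h0
  refine hy ?_
  have := H (y 0) (y 1) (y 2) (by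
    ext j
    have := congrFun hy' j
    simpa [Matrix.vecMul, dotProduct, Fin.sum_univ_three] using this)
  ext i
  fin_cases i
  · exact this.1
  · exact this.2.1
  · exact this.2.2

/-- Differentiating `⟨c, c⟩ = 1` shows that a curve on the sphere has tangential velocity. -/
theorem inner_eq_zero_of_norm_eq_one {c : ℝ → E3} {D : Set ℝ} {t : ℝ} {v : E3}
    (hD : UniqueDiffWithinAt ℝ D t) (ht : t ∈ D) (hc : ∀ s ∈ D, ‖c s‖ = 1)
    (h : HasDerivWithinAt c v D t) : inner ℝ (c t) v = 0 := by
  have h1 := h.inner ℝ h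
  have h2 : HasDerivWithinAt (fun s => inner ℝ (c s) (c s)) 0 D t :=
    (hasDerivWithinAt_const t D (1 : ℝ)).congr
      (fun s hs => by rw [real_inner_self_eq_norm_sq, hc s hs]; norm_num)
      (by rw [real_inner_self_eq_norm_sq, hc t ht]; norm_num)
  have h3 := (h1.derivWithin hD).symm.trans (h2.derivWithin hD)
  rw [real_inner_comm (c t) v] at h3
  linarith

/-- The velocity of a curve moved by a smooth family of maps. -/
theorem hasDerivWithinAt_family {Φ : ℝ → E3 → E3}
    (hΦ : ContDiffOn ℝ ∞ (fun p : ℝ × E3 => Φ p.1 p.2) (Set.univ ×ˢ {0}ᶜ))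
    {c : ℝ → E3} {D : Set ℝ} {t : ℝ} {v : E3} (hc : c t ≠ 0) (h : HasDerivWithinAt c v D t)
    (s : ℝ) :
    HasDerivWithinAt (fun r => Φ s (c r))
      (fderiv ℝ (fun p : ℝ × E3 => Φ p.1 p.2) (s, c t) (0, v)) D t := by
  have hopen : IsOpen ((Set.univ : Set ℝ) ×ˢ ({0}ᶜ : Set E3)) :=
    isOpen_univ.prod isOpen_compl_singleton
  have hmem : ((s, c t) : ℝ × E3) ∈ (Set.univ : Set ℝ) ×ˢ ({0}ᶜ : Set E3) := ⟨trivial, hc⟩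
  have hd : HasFDerivAt (fun p : ℝ × E3 => Φ p.1 p.2)
      (fderiv ℝ (fun p : ℝ × E3 => Φ p.1 p.2) (s, c t)) (s, c t) :=
    ((hΦ.differentiableOn (by simp)).differentiableAt (hopen.mem_nhds hmem)).hasFDerivAt
  exact HasFDerivAt.comp_hasDerivWithinAt (f := fun r => (s, c r)) t hd
    ((hasDerivWithinAt_const t D s).prodMk h)

/-- Joint smoothness in time and position is what makes the spatial derivative continuous in time;
the sign argument for isotopies rests on it. -/
theorem continuous_fderiv_family {Φ : ℝ → E3 → E3}
    (hΦ : ContDiffOn ℝ ∞ (fun p : ℝ × E3 => Φ p.1 p.2) (Set.univ ×ˢ {0}ᶜ)) {x : E3} (hx : x ≠ 0)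
    (v : E3) :
    Continuous fun s => fderiv ℝ (fun p : ℝ × E3 => Φ p.1 p.2) (s, x) (0, v) := by
  have hopen : IsOpen ((Set.univ : Set ℝ) ×ˢ ({0}ᶜ : Set E3)) :=
    isOpen_univ.prod isOpen_compl_singleton
  have h1 := hΦ.continuousOn_fderiv_of_isOpen hopen (by simp)
  have h2 : Continuous fun s : ℝ => fderiv ℝ (fun p : ℝ × E3 => Φ p.1 p.2) (s, x) :=
    h1.comp_continuous (f := fun s : ℝ => (s, x)) (by fun_prop) fun s => ⟨trivial, hx⟩
  exact h2.clm_apply continuous_const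

/-- Follow a crossing through the isotopy: the determinant of its position and its two transported
velocities is continuous in time and never zero, so it has the same sign at time `1` as at time `0`.
-/
theorem combIso_of_isotopy (hI : Isotopy L L') :
    CombIso L L' id id (fun _ => id) (fun _ => id) := by
  obtain ⟨Φ, Ψ, hΦ, hΨ, hinv, h0, hcu, hun⟩ := hI
  have hnorm : ∀ p : LPt n m, p.Valid → ‖p.pos L.curve‖ = 1 :=
    fun p hp => L.norm_eq_one p.1 p.2 hp
  have hpos : ∀ p : LPt n m, p.Valid → p.pos L'.curve = Φ 1 (p.pos L.curve) :=
    fun p hp => hcu p.1 p.2 hp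
  have hdouble : ∀ p q : LPt n m, p.Valid → q.Valid → (L'.Double p q ↔ L.Double p q) := by
    intro p q hp hq
    unfold Double LPt.Double
    rw [hpos p hp, hpos q hq]
    refine and_congr_right fun _ => and_congr_right fun _ => and_congr_right fun _ =>
      ⟨fun h => ?_, fun h => by rw [h]⟩
    rw [← (hinv 1 _ (hnorm p hp)).2.2.1, ← (hinv 1 _ (hnorm q hq)).2.2.1, h]
  refine ⟨fun _ => rfl, fun _ => rfl, fun _ _ h => h, fun _ _ h => h, fun _ _ _ => rfl,
    fun _ _ _ => rfl, fun _ _ _ _ _ h => h, fun _ _ _ _ => Iff.rfl, hdouble,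
    fun p _ => by rw [hun]; rfl, fun p q hd' => ?_⟩
  change L'.RightToLeft p q ↔ L.RightToLeft p q
  have hp := hd'.1
  have hq := hd'.2.1
  have hd := (hdouble p q hp hq).1 hd'
  let A : ℝ → E3 → E3 := fun s v =>
    fderiv ℝ (fun y : ℝ × E3 => Φ y.1 y.2) (s, p.pos L.curve) (0, v)
  have hne : ∀ r : LPt n m, r.Valid → r.pos L.curve ≠ 0 := fun r hr h => by
    have := hnorm r hr
    rw [h, norm_zero] at this
    exact zero_ne_one this
  have hA : ∀ r : LPt n m, r.Valid → r.pos L.curve = p.pos L.curve → ∀ s,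
      HasDerivWithinAt (fun t => Φ s (L.curve r.1 t)) (A s (r.vel L.curve)) r.1.dom r.2 := by
    intro r hr hrp s
    have := hasDerivWithinAt_family hΦ (hne r hr) (L.hasDerivWithinAt_curve hr) s
    simp only [A, ← hrp]
    exact this
  have hinner : ∀ r : LPt n m, r.Valid → r.pos L.curve = p.pos L.curve → ∀ s,
      inner ℝ (Φ s (p.pos L.curve)) (A s (r.vel L.curve)) = 0 := by
    intro r hr hrp s
    rw [← hrp]
    exact inner_eq_zero_of_norm_eq_one (r.1.uniqueDiffOn_dom r.2 hr) hr
      (fun t ht => (hinv s _ (L.norm_eq_one r.1 t ht)).1) (hA r hr hrp s)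
  -- `Ψ s` inverts `Φ s` only on the sphere, so the derivatives need not be inverse on all of space.
  -- Differentiating `Ψ s ∘ Φ s = id` along the curves of the diagram inverts them on the
  -- velocities, which suffices.
  have hback : ∀ s, ∃ B : E3 →L[ℝ] E3, ∀ r : LPt n m, r.Valid →
      r.pos L.curve = p.pos L.curve → B (A s (r.vel L.curve)) = r.vel L.curve := by
    intro s
    refine ⟨(fderiv ℝ (fun y : ℝ × E3 => Ψ y.1 y.2) (s, Φ s (p.pos L.curve))).comp
      (ContinuousLinearMap.inr ℝ ℝ E3), fun r hr hrp => ?_⟩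
    have hne' : Φ s (L.curve r.1 r.2) ≠ 0 := fun h => by
      have := (hinv s _ (hnorm r hr)).1
      rw [show r.pos L.curve = L.curve r.1 r.2 from rfl, h, norm_zero] at this
      exact zero_ne_one this
    have h1 := hasDerivWithinAt_family hΨ hne' (hA r hr hrp s) s
    have h2 : HasDerivWithinAt (L.curve r.1) _ r.1.dom r.2 :=
      h1.congr (fun t ht => ((hinv s _ (L.norm_eq_one r.1 t ht)).2.2.1).symm)
        ((hinv s _ (hnorm r hr)).2.2.1).symm
    have h3 := h2.derivWithin (r.1.uniqueDiffOn_dom r.2 hr)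
    rw [← hrp]
    exact h3.symm
  have hpq : q.pos L.curve = p.pos L.curve := hd.2.2.2.symm
  let d : ℝ → ℝ := fun s => Matrix.det (Matrix.of fun i j : Fin 3 =>
    (![Φ s (p.pos L.curve), A s (p.vel L.curve), A s (q.vel L.curve)] : Fin 3 → E3) i j)
  have hdne : ∀ s, d s ≠ 0 := by
    intro s
    refine det_ne_zero_of_forall fun a b c h => ?_
    -- Pairing with the position kills both tangential terms. Then `B` carries the remaining
    -- relation back to the original velocities, which are independent by transversality.
    have ha : a = 0 := by
      have := congrArg (inner ℝ (Φ s (p.pos L.curve))) h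
      rw [inner_add_right, inner_add_right, inner_smul_right, inner_smul_right, inner_smul_right,
        hinner p hp rfl, hinner q hq hpq, real_inner_self_eq_norm_sq,
        (hinv s _ (hnorm p hp)).1, inner_zero_right] at this
      linarith
    obtain ⟨B, hB⟩ := hback s
    have := congrArg B h
    rw [ha, zero_smul, zero_add, map_add, map_smul, map_smul, hB p hp rfl, hB q hq hpq,
      map_zero] at this
    exact ⟨ha, LinearIndependent.pair_iff.1 (L.transverse p q hd) b c this⟩
  have hdc : Continuous d := by
    have c0 : Continuous fun s => Φ s (p.pos L.curve) :=
      hΦ.continuousOn.comp_continuous (f := fun s : ℝ => (s, p.pos L.curve)) (by fun_prop)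
        fun s => ⟨trivial, hne p hp⟩
    have c1 : Continuous fun s => A s (p.vel L.curve) := continuous_fderiv_family hΦ (hne p hp) _
    have c2 : Continuous fun s => A s (q.vel L.curve) := continuous_fderiv_family hΦ (hne p hp) _
    refine Continuous.matrix_det (continuous_matrix fun i j => ?_)
    fin_cases i
    · exact (EuclideanSpace.proj (𝕜 := ℝ) j).continuous.comp c0
    · exact (EuclideanSpace.proj (𝕜 := ℝ) j).continuous.comp c1
    · exact (EuclideanSpace.proj (𝕜 := ℝ) j).continuous.comp c2
  have hsign : 0 < d 1 ↔ 0 < d 0 := by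
    have key : ∀ a b, 0 < d a → 0 < d b := fun a b ha => by
      by_contra hb
      obtain ⟨s, hs⟩ := mem_range_of_exists_le_of_exists_ge hdc ⟨b, not_lt.1 hb⟩ ⟨a, ha.le⟩
      exact hdne s hs
    exact ⟨key 1 0, key 0 1⟩
  -- `Φ 0` is the identity only on the sphere, hence the comparison of derivatives along the curves.
  have hA0 : ∀ r : LPt n m, r.Valid → r.pos L.curve = p.pos L.curve →
      A 0 (r.vel L.curve) = r.vel L.curve := by
    intro r hr hrp
    have h2 : HasDerivWithinAt (L.curve r.1) _ r.1.dom r.2 :=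
      (hA r hr hrp 0).congr (fun t ht => (h0 _ (L.norm_eq_one r.1 t ht)).symm)
        (h0 _ (hnorm r hr)).symm
    exact (h2.derivWithin (r.1.uniqueDiffOn_dom r.2 hr)).symm
  have hA1 : ∀ r : LPt n m, r.Valid → r.pos L.curve = p.pos L.curve →
      A 1 (r.vel L.curve) = r.vel L'.curve := by
    intro r hr hrp
    have h2 : HasDerivWithinAt (L'.curve r.1) _ r.1.dom r.2 :=
      (hA r hr hrp 1).congr (fun t ht => hcu r.1 t ht) (hcu r.1 r.2 hr)
    exact (h2.derivWithin (r.1.uniqueDiffOn_dom r.2 hr)).symm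
  unfold RightToLeft
  rw [hpos p hp, ← hA1 p hp rfl, ← hA1 q hq hpq]
  refine hsign.trans ?_
  simp only [d]
  rw [h0 _ (hnorm p hp), hA0 p hp rfl, hA0 q hq hpq]

end LinkoidDiagram

/-! # Colorings in local terms -/

namespace LinkoidDiagram

variable {n m : ℕ} {L L' : LinkoidDiagram n m}

theorem finite_under_inter_Icc (L : LinkoidDiagram n m) (k : LComp n m) :
    {s : ℝ | s ∈ Set.Icc (0 : ℝ) 1 ∧ (k, s) ∈ L.under}.Finite := by
  have hU : {p : LPt n m | p.2 ∈ Set.Icc (0 : ℝ) 1 ∧ p ∈ L.under}.Finite :=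
    L.finite_double.subset fun p hp => ⟨hp.1, L.under_double p hp.2⟩
  exact (hU.preimage (f := fun s : ℝ => ((k, s) : LPt n m))
    (fun s _ t _ h => congrArg Prod.snd h)).subset fun s hs => hs

theorem under_same_add_int (L : LinkoidDiagram n m) (j : Fin m) (s : ℝ) (z : ℤ) :
    (Sum.inr j, s + z) ∈ L.under ↔ (Sum.inr j, s) ∈ L.under :=
  (L.under_same (Sum.inr j, s) (Sum.inr j, s + z) ⟨rfl, Or.inr ⟨rfl, z, rfl⟩⟩).symm

/-- The under-crossing points are isolated. -/
theorem exists_forall_notMem_under (L : LinkoidDiagram n m) (k : LComp n m) (t : ℝ) :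
    ∃ ε > 0, ∀ s, s ≠ t → |s - t| < ε → (k, s) ∉ L.under := by
  have hfin : {s : ℝ | s ∈ Set.Ioo (t - 1) (t + 1) ∧ (k, s) ∈ L.under}.Finite := by
    cases k with
    | inl i =>
      refine (L.finite_under_inter_Icc (Sum.inl i)).subset fun s hs => ⟨?_, hs.2⟩
      obtain ⟨q, hq⟩ := L.under_double _ hs.2
      exact hq.1
    | inr j =>
      -- On a circle, a parameter within distance `1` of `t` has its floor within `1` of `⌊t⌋`, so
      -- three integer translates of the finite set in `[0, 1]` cover all cases.
      have hbig : (⋃ z ∈ Set.Icc (⌊t⌋ - 1) (⌊t⌋ + 1), (fun s : ℝ => s + (z : ℤ)) ''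
          {s : ℝ | s ∈ Set.Icc (0 : ℝ) 1 ∧ (Sum.inr j, s) ∈ L.under}).Finite :=
        (Set.finite_Icc _ _).biUnion fun z _ => (L.finite_under_inter_Icc (Sum.inr j)).image _
      refine hbig.subset fun s hs => ?_
      have h1 : ⌊t⌋ - 1 ≤ ⌊s⌋ := by
        rw [← Int.floor_sub_one]
        exact Int.floor_le_floor hs.1.1.le
      have h2 : ⌊s⌋ ≤ ⌊t⌋ + 1 := by
        rw [← Int.floor_add_one]
        exact Int.floor_le_floor hs.1.2.le
      refine Set.mem_biUnion (x := ⌊s⌋) ⟨h1, h2⟩ ⟨Int.fract s, ⟨⟨Int.fract_nonneg s,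
        (Int.fract_lt_one s).le⟩, ?_⟩, Int.fract_add_floor s⟩
      rw [← L.under_same_add_int j _ ⌊s⌋, Int.fract_add_floor]
      exact hs.2
  have hN : ({s : ℝ | s ∈ Set.Ioo (t - 1) (t + 1) ∧ (k, s) ∈ L.under} \ {t})ᶜ ∈ nhds t :=
    (hfin.subset Set.sdiff_subset).isClosed.isOpen_compl.mem_nhds fun h => h.2 rfl
  obtain ⟨ε, hε, hb⟩ := Metric.mem_nhds_iff.1 hN
  refine ⟨min ε 1, lt_min hε one_pos, fun s hst hs hu => ?_⟩
  refine hb (?_ : s ∈ Metric.ball t ε) ⟨⟨?_, hu⟩, hst⟩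
  · rw [Metric.mem_ball, Real.dist_eq]
    exact hs.trans_le (min_le_left _ _)
  · have := abs_lt.1 (hs.trans_le (min_le_right _ _))
    constructor <;> linarith [this.1, this.2]

theorem eventually_forall_uIcc {P : ℝ → Prop} {t : ℝ} (h : ∀ᶠ s in nhds t, P s) :
    ∀ᶠ s in nhds t, ∀ r ∈ Set.uIcc s t, P r := by
  obtain ⟨ε, hε, hb⟩ := Metric.eventually_nhds_iff_ball.1 h
  filter_upwards [Metric.ball_mem_nhds t hε] with s hs r hr
  rw [Real.ball_eq_Ioo] at hs hb
  exact hb r (Set.ordConnected_Ioo.uIcc_subset hs ⟨by linarith, by linarith⟩ hr)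

theorem eventually_notMem_under (L : LinkoidDiagram n m) {k : LComp n m} {t : ℝ}
    (ht : (k, t) ∉ L.under) : ∀ᶠ s in nhds t, (k, s) ∉ L.under := by
  obtain ⟨ε, hε, hb⟩ := L.exists_forall_notMem_under k t
  filter_upwards [Metric.ball_mem_nhds t hε] with s hs
  by_cases h : s = t
  · rwa [h]
  · exact hb s h (by rwa [Metric.mem_ball, Real.dist_eq] at hs)

theorem eventually_clear_left (L : LinkoidDiagram n m) (k : LComp n m) (t : ℝ) :
    ∀ᶠ p in nhdsWithin t (Set.Iio t), ∀ s ∈ Set.Ico p t, (k, s) ∉ L.under := by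
  obtain ⟨ε, hε, hb⟩ := L.exists_forall_notMem_under k t
  filter_upwards [Ioo_mem_nhdsLT (show t - ε < t by linarith)] with p hp s hs
  refine hb s hs.2.ne ?_
  rw [abs_lt]
  constructor <;> linarith [hs.1, hs.2, hp.1]

theorem eventually_clear_right (L : LinkoidDiagram n m) (k : LComp n m) (t : ℝ) :
    ∀ᶠ q in nhdsWithin t (Set.Ioi t), ∀ s ∈ Set.Ioc t q, (k, s) ∉ L.under := by
  obtain ⟨ε, hε, hb⟩ := L.exists_forall_notMem_under k t
  filter_upwards [Ioo_mem_nhdsGT (show t < t + ε by linarith)] with p hp s hs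
  refine hb s hs.1.ne' ?_
  rw [abs_lt]
  constructor <;> linarith [hs.1, hs.2, hp.2]

variable {X : Type u} [Quandle X]

theorem IsColoring.eventually_eq {f : LPt n m → X} (hf : L.IsColoring f) {k : LComp n m} {t : ℝ}
    (ht : t ∈ k.dom) (hu : (k, t) ∉ L.under) :
    ∀ᶠ s in nhdsWithin t k.dom, f (k, s) = f (k, t) := by
  filter_upwards [self_mem_nhdsWithin, nhdsWithin_le_nhds
    (eventually_forall_uIcc (L.eventually_notMem_under hu))] with s hs hcl
  exact hf.joined k s t hs ht hcl

theorem IsColoring.eventually_cross {f : LPt n m → X} (hf : L.IsColoring f) {o u : LPt n m}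
    (hd : L.Double o u) (hu : u ∈ L.under) :
    ∀ᶠ p in nhdsWithin u.2 (Set.Iio u.2), ∀ᶠ q in nhdsWithin u.2 (Set.Ioi u.2),
      f (u.1, q) = signedAct (L.RightToLeft o u) (f o) (f (u.1, p)) := by
  filter_upwards [L.eventually_clear_left u.1 u.2, self_mem_nhdsWithin,
    nhdsWithin_le_nhds (Double.symm hd).dom_mem_nhds] with p hclp hp hpd
  filter_upwards [L.eventually_clear_right u.1 u.2, self_mem_nhdsWithin,
    nhdsWithin_le_nhds (Double.symm hd).dom_mem_nhds] with q hclq hq hqd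
  exact hf.cross u.1 o u.2 p q hd hu hpd hqd hp hq hclp hclq

/-- Two parameters of one point differ by a translation that respects the whole component: by `0` on
an interval, by an integer on a circle. Local statements can thus be moved between parameters. -/
theorem exists_shift {p p' : LPt n m} (h : p.Same p') :
    ∃ z : ℝ, p' = (p.1, p.2 + z) ∧ ∀ s, LPt.Same (p.1, s) (p.1, s + z) ∧
      (s ∈ p.1.dom ↔ s + z ∈ p.1.dom) := by
  obtain ⟨k, t⟩ := p
  obtain ⟨k', t'⟩ := p'
  obtain ⟨h1, h2⟩ := h
  simp only at h1 h2
  subst h1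
  rcases h2 with rfl | ⟨hr, z, rfl⟩
  · exact ⟨0, by simp, fun s => by simp [LPt.Same.refl]⟩
  · exact ⟨z, rfl, fun s => ⟨⟨rfl, Or.inr ⟨hr, z, rfl⟩⟩, by simp [LComp.dom_eq_univ hr]⟩⟩

theorem tendsto_add_right (t z : ℝ) {A B : Set ℝ} (h : ∀ s ∈ A, s + z ∈ B) :
    Filter.Tendsto (fun s => s + z) (nhdsWithin t A) (nhdsWithin (t + z) B) :=
  tendsto_nhdsWithin_of_tendsto_nhds_of_eventually_within _
    ((continuous_add_const z).tendsto t |>.mono_left nhdsWithin_le_nhds)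
    (by filter_upwards [self_mem_nhdsWithin] with s hs using h s hs)

/-- A coloring can be checked locally, at one parameter value for each point. -/
theorem isColoring_of_local {f : LPt n m → X}
    (same : ∀ p q : LPt n m, p.Same q → p.Valid → p ∉ L.under → f p = f q)
    (loc : ∀ p : LPt n m, p.Valid → p ∉ L.under → ∃ p' : LPt n m, p.Same p' ∧
      ∀ᶠ s in nhdsWithin p'.2 p'.1.dom, f (p'.1, s) = f p')
    (cross : ∀ o u, L.Double o u → u ∈ L.under → ∃ o' u' : LPt n m, o.Same o' ∧ u.Same u' ∧
      ∀ᶠ p in nhdsWithin u'.2 (Set.Iio u'.2), ∀ᶠ q in nhdsWithin u'.2 (Set.Ioi u'.2),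
        f (u'.1, q) = signedAct (L.RightToLeft o u) (f o') (f (u'.1, p))) :
    L.IsColoring f := by
  have joined : ∀ (k : LComp n m) (s t : ℝ), s ∈ k.dom → t ∈ k.dom →
      (∀ r ∈ Set.uIcc s t, (k, r) ∉ L.under) → f (k, s) = f (k, t) := by
    intro k s t hs ht hcl
    have hsub : Set.uIcc s t ⊆ k.dom := k.convex_dom.ordConnected.uIcc_subset hs ht
    -- An interval is connected, so local constancy, checked at each of its points, gives equal
    -- values at its ends.
    refine isPreconnected_uIcc.induction₂ (fun x y => f (k, x) = f (k, y)) (fun x hx => ?_)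
      (fun x y z _ _ _ h h' => h.trans h') (fun x y _ _ h => h.symm) Set.left_mem_uIcc
      Set.right_mem_uIcc
    have hxd := hsub hx
    have hxu := hcl x hx
    obtain ⟨p', hp', hev⟩ := loc (k, x) hxd hxu
    obtain ⟨z, rfl, hz⟩ := exists_shift hp'
    have hev' := (tendsto_add_right x z (A := k.dom) (B := k.dom)
      fun s hs => (hz s).2.1 hs).eventually hev
    filter_upwards [nhdsWithin_mono x hsub hev', self_mem_nhdsWithin] with y hy hy'
    rw [same _ _ (hz x).1 hxd hxu, same _ _ (hz y).1 (hsub hy') (hcl y hy')]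
    exact hy.symm
  refine ⟨same, joined, ?_⟩
  intro k o t p q hd hu hp hq hpt htq hclp hclq
  obtain ⟨o', u', ho, hu', hev⟩ := cross o (k, t) hd hu
  obtain ⟨z, rfl, hz⟩ := exists_shift hu'
  have hev1 := (tendsto_add_right t z (A := Set.Iio t) (B := Set.Iio (t + z))
    fun s hs => by simpa using hs).eventually hev
  -- The local relation holds at some `p₀` and `q₀` close to the crossing; constancy on the clear
  -- intervals transports it to `p` and `q`. The choice of `q₀` may depend on `p₀`.
  obtain ⟨p₀, ⟨hp₀, hp₀'⟩, hev2⟩ := ((Filter.eventually_of_mem (Ioo_mem_nhdsLT hpt)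
    fun _ h => h).and hev1).exists
  have hev3 := (tendsto_add_right t z (A := Set.Ioi t) (B := Set.Ioi (t + z))
    fun s hs => by simpa using hs).eventually hev2
  obtain ⟨q₀, ⟨hq₀, hq₀'⟩, h⟩ := ((Filter.eventually_of_mem (Ioo_mem_nhdsGT htq)
    fun _ h => h).and hev3).exists
  have hoc := k.convex_dom.ordConnected.out hp hq
  have hp₀d : p₀ ∈ k.dom := hoc ⟨hp₀.le, by linarith⟩
  have hq₀d : q₀ ∈ k.dom := hoc ⟨by linarith, hq₀'.le⟩
  have e1 : f (k, p) = f (k, p₀) := joined k p p₀ hp hp₀d fun s hs => by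
    rw [Set.uIcc_of_le hp₀.le] at hs
    exact hclp s ⟨hs.1, hs.2.trans_lt hp₀'⟩
  have e2 : f (k, q) = f (k, q₀) := joined k q q₀ hq hq₀d fun s hs => by
    rw [Set.uIcc_of_ge hq₀'.le] at hs
    exact hclq s ⟨hq₀.trans_le hs.1, hs.2⟩
  rw [e1, e2, same _ _ (hz p₀).1 hp₀d (hclp _ ⟨hp₀.le, hp₀'⟩),
    same _ _ (hz q₀).1 hq₀d (hclq _ ⟨hq₀, hq₀'.le⟩), same _ _ ho hd.1 (Double.over_notMem hd hu)]
  exact h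

end LinkoidDiagram

/-! # Strands -/

namespace LStrand

variable {n m : ℕ}

theorem dom_mem_nhds (σ : LStrand n m) {t : ℝ} (ht : t ∈ Set.Icc σ.a σ.b) :
    σ.comp.dom ∈ nhds t := by
  rcases σ with ⟨k, a, b, hab, h1, h2⟩
  cases k with
  | inl i =>
    have := h1 rfl
    exact Icc_mem_nhds (this.1.trans_le ht.1) (ht.2.trans_lt this.2)
  | inr j => exact Filter.univ_mem

theorem valid_pt (σ : LStrand n m) {t : ℝ} (ht : t ∈ Set.Icc σ.a σ.b) : (σ.pt t).Valid :=
  mem_of_mem_nhds (σ.dom_mem_nhds ht)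

theorem mem_points_congr (σ : LStrand n m) {p q : LPt n m} (h : p.Same q) :
    p ∈ σ.points ↔ q ∈ σ.points :=
  ⟨fun ⟨t, ht, hs⟩ => ⟨t, ht, hs.trans h⟩, fun ⟨t, ht, hs⟩ => ⟨t, ht, hs.trans h.symm⟩⟩

theorem pt_mem_points (σ : LStrand n m) {t : ℝ} (ht : t ∈ Set.Icc σ.a σ.b) :
    σ.pt t ∈ σ.points := ⟨t, ht, LPt.Same.refl _⟩

/-- A strand of an open component has its parameters strictly between `0` and `1`. Every local move
therefore leaves the basepoints alone. -/
theorem endpoint_notMem_points (σ : LStrand n m) (j : Fin (2 * n)) :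
    (LPt.endpoint j : LPt n m) ∉ σ.points := by
  rintro ⟨t, ht, h1, h2⟩
  have hl : σ.comp.isLeft = true := by
    simp only at h1
    rw [h1]
    rfl
  have := σ.isOpen hl
  have hr : ¬ σ.comp.isRight = true := by
    simp only at h1
    rw [h1]
    simp [LPt.endpoint]
  rcases h2 with h2 | h2
  · simp only [LPt.endpoint] at h2
    split_ifs at h2
    · linarith [ht.1]
    · linarith [ht.2]
  · exact hr h2.1

/-- A point of a strand near the parameter interval has its parameter in the interval. -/
theorem eventually_mem_Icc (σ : LStrand n m) {t : ℝ} (ht : t ∈ Set.Icc σ.a σ.b) :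
    ∀ᶠ s in nhds t, (σ.comp, s) ∈ σ.points → s ∈ Set.Icc σ.a σ.b := by
  by_cases hr : σ.comp.isRight = true
  · have hlt := σ.isClosed hr
    -- The radius is the length of the circle left over by the strand: a nonzero integer shift of a
    -- strand parameter lies at least this far from `t`.
    filter_upwards [Metric.ball_mem_nhds t (show 0 < 1 - (σ.b - σ.a) by linarith)] with s hs
    rintro ⟨r, hr, -, h | ⟨-, z, hz⟩⟩
    · rwa [← show r = s from h]
    · simp only at hz
      rw [Metric.mem_ball, Real.dist_eq, abs_lt] at hs
      have h1 : (-1 : ℝ) < z := by linarith [hr.1, hr.2, ht.1, ht.2]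
      have h2 : (z : ℝ) < 1 := by linarith [hr.1, hr.2, ht.1, ht.2]
      have h0 : z = 0 := by
        have h1' : (-1 : ℤ) < z := by exact_mod_cast h1
        have h2' : z < (1 : ℤ) := by exact_mod_cast h2
        omega
      rw [hz, h0]
      simpa using hr
  · refine Filter.Eventually.of_forall fun s => ?_
    rintro ⟨r, hr', -, h | h⟩
    · rwa [← show r = s from h]
    · exact absurd h.1 hr

theorem eventually_notMem_points (σ : LStrand n m) {k : LComp n m} {t : ℝ}
    (ht : (k, t) ∉ σ.points) : ∀ᶠ s in nhds t, (k, s) ∉ σ.points := by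
  by_cases hk : σ.comp = k
  · subst hk
    by_cases hr : σ.comp.isRight = true
    · have hout : ∀ z : ℤ, ¬ (σ.a + z ≤ t ∧ t ≤ σ.b + z) := fun z hz =>
        ht ⟨t - z, ⟨by linarith [hz.1], by linarith [hz.2]⟩, rfl, Or.inr ⟨hr, z, by simp⟩⟩
      -- The translate by `⌊t - σ.a⌋` is the last one that starts at or before `t`, so `t` lies in
      -- the open gap between its end and the start of the next.
      have h1 : σ.a + ⌊t - σ.a⌋ ≤ t := by linarith [Int.floor_le (t - σ.a)]
      have h2 : t < σ.a + ⌊t - σ.a⌋ + 1 := by linarith [Int.lt_floor_add_one (t - σ.a)]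
      have h3 : σ.b + ⌊t - σ.a⌋ < t := by
        by_contra h
        exact hout _ ⟨h1, not_lt.1 h⟩
      filter_upwards [Ioo_mem_nhds h3 h2] with s hs
      have key : ∀ z : ℤ, ¬ (σ.a + z ≤ s ∧ s ≤ σ.b + z) := by
        rintro z ⟨hz1, hz2⟩
        rcases le_or_gt z ⌊t - σ.a⌋ with h | h
        · have : (z : ℝ) ≤ ⌊t - σ.a⌋ := by exact_mod_cast h
          linarith [hs.1]
        · have : ((⌊t - σ.a⌋ + 1 : ℤ) : ℝ) ≤ z := by exact_mod_cast h
          push_cast at this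
          linarith [hs.2]
      rintro ⟨r, hr', -, h | ⟨-, z, hz⟩⟩
      · simp only at h
        refine key 0 ?_
        simp only [Int.cast_zero, add_zero, ← h]
        exact hr'
      · simp only at hz
        exact key z ⟨by linarith [hr'.1], by linarith [hr'.2]⟩
    · have : t ∉ Set.Icc σ.a σ.b := fun h => ht (σ.pt_mem_points h)
      filter_upwards [isClosed_Icc.isOpen_compl.mem_nhds this] with s hs
      rintro ⟨r, hr', -, h | h⟩
      · exact hs (by rwa [← show r = s from h])
      · exact hr h.1
  · refine Filter.Eventually.of_forall fun s => ?_
    rintro ⟨r, -, h, -⟩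
    exact hk h

theorem pt_same_pt_iff (σ : LStrand n m) {s t : ℝ} (hs : s ∈ Set.Icc σ.a σ.b)
    (ht : t ∈ Set.Icc σ.a σ.b) : (σ.pt s).Same (σ.pt t) ↔ s = t := by
  refine ⟨?_, fun h => h ▸ LPt.Same.refl _⟩
  rintro ⟨-, h | ⟨hr, z, hz⟩⟩
  · exact h
  · have hlt := σ.isClosed hr
    simp only [pt] at hz
    have h1 : (-1 : ℝ) < z := by linarith [hs.1, hs.2, ht.1, ht.2]
    have h2 : (z : ℝ) < 1 := by linarith [hs.1, hs.2, ht.1, ht.2]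
    have h0 : z = 0 := by
      have h1' : (-1 : ℤ) < z := by exact_mod_cast h1
      have h2' : z < (1 : ℤ) := by exact_mod_cast h2
      omega
    rw [hz, h0]
    simp

end LStrand

theorem pt_same_pt {n m r : ℕ} {σ : Fin r → LStrand n m}
    (hdis : ∀ i j, i ≠ j → Disjoint (σ i).points (σ j).points) {i j : Fin r} {s t : ℝ}
    (hs : s ∈ Set.Icc (σ i).a (σ i).b) (ht : t ∈ Set.Icc (σ j).a (σ j).b)
    (h : ((σ i).pt s).Same ((σ j).pt t)) : i = j ∧ s = t := by
  have hij : i = j := by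
    by_contra hne
    exact Set.disjoint_left.1 (hdis i j hne) ⟨s, hs, h⟩ ((σ j).pt_mem_points ht)
  subst hij
  exact ⟨rfl, ((σ i).pt_same_pt_iff hs ht).1 h⟩

/-! # Gluing colorings along a local change -/

namespace LinkoidDiagram

variable {n m r : ℕ} {L L' : LinkoidDiagram n m} {σ : Fin r → LStrand n m}

section

variable {X : Type u} [Quandle X]

/-- The functions `g` on the strands `σ` satisfy the coloring conditions on the strand `σ i`. -/
structure IsStrandColoring (L : LinkoidDiagram n m) (σ : Fin r → LStrand n m)
    (g : Fin r → ℝ → X) (i : Fin r) : Prop where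
  joined : ∀ s ∈ Set.Icc (σ i).a (σ i).b, ∀ t ∈ Set.Icc (σ i).a (σ i).b,
    (∀ u ∈ Set.uIcc s t, (σ i).pt u ∉ L.under) → g i s = g i t
  cross : ∀ (j : Fin r) (o t p q : ℝ), o ∈ Set.Icc (σ j).a (σ j).b →
    L.Double ((σ j).pt o) ((σ i).pt t) → (σ i).pt t ∈ L.under →
    p ∈ Set.Icc (σ i).a (σ i).b → q ∈ Set.Icc (σ i).a (σ i).b → p < t → t < q →
    (∀ s ∈ Set.Ico p t, (σ i).pt s ∉ L.under) → (∀ s ∈ Set.Ioc t q, (σ i).pt s ∉ L.under) →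
    g i q = signedAct (L.RightToLeft ((σ j).pt o) ((σ i).pt t)) (g j o) (g i p)

/-- The colors at the initial ends of the strands can be prescribed and determine the coloring; the
function `F` gives the colors at the final ends. -/
structure HasTransfer (L : LinkoidDiagram n m) (σ : Fin r → LStrand n m)
    (F : (Fin r → X) → Fin r → X) : Prop where
  exists_coloring : ∀ x : Fin r → X, ∃ g : Fin r → ℝ → X, (∀ i, L.IsStrandColoring σ g i) ∧
    ∀ i, g i (σ i).a = x i
  final : ∀ g : Fin r → ℝ → X, (∀ i, L.IsStrandColoring σ g i) →
    ∀ i, g i (σ i).b = F (fun j => g j (σ j).a) i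
  unique : ∀ g g' : Fin r → ℝ → X, (∀ i, L.IsStrandColoring σ g i) →
    (∀ i, L.IsStrandColoring σ g' i) → (∀ i, g i (σ i).a = g' i (σ i).a) →
    ∀ i, ∀ t ∈ Set.Icc (σ i).a (σ i).b, (σ i).pt t ∉ L.under → g i t = g' i t

theorem IsColoring.isStrandColoring {f : LPt n m → X} (hf : L.IsColoring f)
    (σ : Fin r → LStrand n m) (i : Fin r) :
    L.IsStrandColoring σ (fun i t => f ((σ i).pt t)) i where
  joined s hs t ht h := hf.joined _ s t ((σ i).valid_pt hs) ((σ i).valid_pt ht) h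
  cross j o t p q _ hd hu hp hq hpt htq h1 h2 :=
    hf.cross (σ i).comp ((σ j).pt o) t p q hd hu ((σ i).valid_pt hp) ((σ i).valid_pt hq) hpt htq
      h1 h2

end

/-- No end of a strand is a double point. -/
def EndsSimple (L : LinkoidDiagram n m) (σ : Fin r → LStrand n m) : Prop :=
  ∀ i q, ¬ L.Double ((σ i).pt (σ i).a) q ∧ ¬ L.Double ((σ i).pt (σ i).b) q

theorem EndsSimple.left_notMem (h : L.EndsSimple σ) (i : Fin r) :
    (σ i).pt (σ i).a ∉ L.under := fun hu => by
  obtain ⟨q, hq⟩ := L.under_double _ hu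
  exact (h i q).1 hq

theorem EndsSimple.right_notMem (h : L.EndsSimple σ) (i : Fin r) :
    (σ i).pt (σ i).b ∉ L.under := fun hu => by
  obtain ⟨q, hq⟩ := L.under_double _ hu
  exact (h i q).2 hq

theorem LocalChange.symm (h : LocalChange L L' σ) : LocalChange L' L σ := by
  obtain ⟨h1, ⟨β, b1, b2, b3, b4, b5⟩, h3, h4⟩ := h
  exact ⟨h1, ⟨β, b1, b2, b3, b5, b4⟩,
    fun p hp hi => ⟨(h3 p hp hi).1.symm, (h3 p hp hi).2.symm⟩,
    fun i => ⟨(h4 i).1.symm, (h4 i).2.symm⟩⟩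

/-- Lying in the disc depends only on the position on the sphere, which the two points of a crossing
share. No crossing mixes a strand with the outside. -/
theorem LocalChange.mem_points_of_double (h : LocalChange L L' σ) {p q : LPt n m}
    (hd : L.Double p q) (hp : ∃ i, p ∈ (σ i).points) : ∃ i, q ∈ (σ i).points := by
  obtain ⟨-, ⟨β, -, -, -, ⟨b4, -, -⟩, -⟩, -, -⟩ := h
  rw [← b4 q hd.2.1, ← hd.2.2.2, b4 p hd.1]
  exact hp

theorem eventually_outside {p : LPt n m} (hp : ∀ i, p ∉ (σ i).points) :
    ∀ᶠ s in nhds p.2, ∀ i, (p.1, s) ∉ (σ i).points :=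
  Filter.eventually_all.2 fun i => (σ i).eventually_notMem_points (hp i)

/-- Being outside the strands is an open condition on the parameter, so the curves agree near `p`
and have the same derivative. -/
theorem LocalChange.vel_eq (h : LocalChange L L' σ) {p : LPt n m} (hv : p.Valid)
    (hp : ∀ i, p ∉ (σ i).points) : p.vel L'.curve = p.vel L.curve := by
  refine Filter.EventuallyEq.derivWithin_eq ?_ (h.2.2.1 p hv hp).1
  filter_upwards [self_mem_nhdsWithin, nhdsWithin_le_nhds (eventually_outside hp)] with s hs hs'
  exact (h.2.2.1 (p.1, s) hs hs').1

theorem LocalChange.double_iff (h : LocalChange L L' σ) {p q : LPt n m}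
    (hp : ∀ i, p ∉ (σ i).points) (hq : ∀ i, q ∉ (σ i).points) :
    L'.Double p q ↔ L.Double p q := by
  refine and_congr_right fun hvp => and_congr_right fun hvq => and_congr_right fun _ => ?_
  rw [(h.2.2.1 p hvp hp).1, (h.2.2.1 q hvq hq).1]

theorem LocalChange.rightToLeft_iff (h : LocalChange L L' σ) {p q : LPt n m} (hvp : p.Valid)
    (hvq : q.Valid) (hp : ∀ i, p ∉ (σ i).points) (hq : ∀ i, q ∉ (σ i).points) :
    L'.RightToLeft p q ↔ L.RightToLeft p q := by
  unfold RightToLeft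
  rw [(h.2.2.1 p hvp hp).1, h.vel_eq hvp hp, h.vel_eq hvq hq]

/-- The points outside the strands and the ends of the strands, each related to itself. -/
def OuterRel (σ : Fin r → LStrand n m) (p p' : LPt n m) : Prop :=
  p = p' ∧ ((∀ i, p ∉ (σ i).points) ∨ ∃ i, p = (σ i).pt (σ i).a ∨ p = (σ i).pt (σ i).b)

theorem outerRel_endpoint (σ : Fin r → LStrand n m) (j : Fin (2 * n)) :
    OuterRel σ (LPt.endpoint j) (LPt.endpoint j) :=
  ⟨rfl, Or.inl fun i => (σ i).endpoint_notMem_points j⟩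

theorem flip_outerRel (σ : Fin r → LStrand n m) : flip (OuterRel σ) = OuterRel σ := by
  funext p q
  refine propext ⟨?_, ?_⟩ <;> · rintro ⟨rfl, h⟩; exact ⟨rfl, h⟩

variable {X : Type u} [Quandle X]

/-- Colorings of the outside of a disc and of the strands inside it fit together. -/
theorem LocalChange.exists_glue (h : LocalChange L L' σ) (hL : L.EndsSimple σ)
    (hL' : L'.EndsSimple σ) {f : LPt n m → X} (hf : L.IsColoring f) {g : Fin r → ℝ → X}
    (hg : ∀ i, L'.IsStrandColoring σ g i) (ha : ∀ i, g i (σ i).a = f ((σ i).pt (σ i).a))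
    (hb : ∀ i, g i (σ i).b = f ((σ i).pt (σ i).b)) :
    ∃ f' : LPt n m → X, L'.IsColoring f' ∧ ∀ p p', OuterRel σ p p' → f p = f' p' := by
  classical
  have hdis := h.1
  -- The strands are disjoint and each has injective parameters, so `g` on the strands and `f`
  -- elsewhere define one function.
  obtain ⟨f', hA, hB⟩ : ∃ f' : LPt n m → X,
      (∀ i, ∀ t ∈ Set.Icc (σ i).a (σ i).b, ∀ p, ((σ i).pt t).Same p → f' p = g i t) ∧
      ∀ p, (∀ i, p ∉ (σ i).points) → f' p = f p := by
    have key : ∀ p : LPt n m, ∃ x : X,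
        (∀ i, ∀ t ∈ Set.Icc (σ i).a (σ i).b, ((σ i).pt t).Same p → x = g i t) ∧
        ((∀ i, p ∉ (σ i).points) → x = f p) := by
      intro p
      by_cases hp : ∃ i, p ∈ (σ i).points
      · obtain ⟨i, t, ht, hs⟩ := hp
        refine ⟨g i t, fun j s hs' hss => ?_, fun hno => absurd ⟨t, ht, hs⟩ (hno i)⟩
        obtain ⟨rfl, rfl⟩ := pt_same_pt hdis ht hs' (LPt.Same.trans hs hss.symm)
        rfl
      · rw [not_exists] at hp
        exact ⟨f p, fun i t ht hs => absurd ⟨t, ht, hs⟩ (hp i), fun _ => rfl⟩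
    choose f' h1 h2 using key
    exact ⟨f', fun i t ht p hs => h1 p i t ht hs, h2⟩
  have hApt : ∀ i, ∀ t ∈ Set.Icc (σ i).a (σ i).b, f' ((σ i).comp, t) = g i t :=
    fun i t ht => hA i t ht _ (LPt.Same.refl _)
  refine ⟨f', isColoring_of_local ?_ ?_ ?_, ?_⟩
  · intro p q hs hv hu
    by_cases hp : ∃ i, p ∈ (σ i).points
    · obtain ⟨i, t, ht, hst⟩ := hp
      rw [hA i t ht p hst, hA i t ht q (LPt.Same.trans hst hs)]
    · rw [not_exists] at hp
      have hq : ∀ i, q ∉ (σ i).points := fun i hi => hp i (((σ i).mem_points_congr hs).2 hi)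
      rw [hB p hp, hB q hq]
      exact hf.same p q hs hv fun hu' => hu ((h.2.2.1 p hv hp).2.2 hu')
  · intro p hv hu
    by_cases hp : ∃ i, p ∈ (σ i).points
    · obtain ⟨i, t, ht, hst⟩ := hp
      have htu : (σ i).pt t ∉ L'.under := fun h' => hu ((L'.under_same _ _ hst).1 h')
      refine ⟨(σ i).pt t, LPt.Same.symm hst, ?_⟩
      change ∀ᶠ s in nhdsWithin t (σ i).comp.dom, f' ((σ i).comp, s) = f' ((σ i).comp, t)
      rw [hApt i t ht]
      have hin : ∀ᶠ s in nhds t, s ∈ Set.Icc (σ i).a (σ i).b → f' ((σ i).comp, s) = g i t := by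
        filter_upwards [eventually_forall_uIcc (L'.eventually_notMem_under htu)] with s hs hsI
        rw [hApt i s hsI]
        exact (hg i).joined s hsI t ht hs
      have hothers : ∀ᶠ s in nhds t, ∀ j, j ≠ i → ((σ i).comp, s) ∉ (σ j).points :=
        Filter.eventually_all.2 fun j => by
          by_cases hj : j = i
          · exact Filter.Eventually.of_forall fun s hs => absurd hj hs
          · have := (σ j).eventually_notMem_points (k := (σ i).comp) (t := t) fun hm =>
              Set.disjoint_left.1 (hdis j i hj) hm ((σ i).pt_mem_points ht)
            filter_upwards [this] with s hs _ using hs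
      -- The parameter can leave the strand near `t` only if `t` is an end. There `f` is locally
      -- constant, as the end is no under-crossing of `L`, and `g` has the same value.
      have hout : ∀ᶠ s in nhdsWithin t (σ i).comp.dom,
          s ∉ Set.Icc (σ i).a (σ i).b → f ((σ i).comp, s) = g i t := by
        by_cases hta : t = (σ i).a
        · subst hta
          filter_upwards [hf.eventually_eq ((σ i).valid_pt ht) (hL.left_notMem i)] with s hs _
          rw [hs, ha i]
          rfl
        by_cases htb : t = (σ i).b
        · subst htb
          filter_upwards [hf.eventually_eq ((σ i).valid_pt ht) (hL.right_notMem i)] with s hs _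
          rw [hs, hb i]
          rfl
        · refine nhdsWithin_le_nhds ?_
          filter_upwards [Icc_mem_nhds (lt_of_le_of_ne ht.1 (Ne.symm hta))
            (lt_of_le_of_ne ht.2 htb)] with s hs hs'
          exact absurd hs hs'
      filter_upwards [nhdsWithin_le_nhds hin, nhdsWithin_le_nhds hothers, hout,
        nhdsWithin_le_nhds ((σ i).eventually_mem_Icc ht)] with s h1 h2 h3 h4
      by_cases hs : s ∈ Set.Icc (σ i).a (σ i).b
      · exact h1 hs
      · rw [hB, h3 hs]
        intro j
        by_cases hj : j = i
        · subst hj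
          exact fun hm => hs (h4 hm)
        · exact h2 j hj
    · rw [not_exists] at hp
      refine ⟨p, LPt.Same.refl p, ?_⟩
      have hu' : p ∉ L.under := fun h' => hu ((h.2.2.1 p hv hp).2.2 h')
      filter_upwards [hf.eventually_eq (k := p.1) (t := p.2) hv hu',
        nhdsWithin_le_nhds (eventually_outside hp)] with s h1 h2
      rw [hB _ h2, hB p hp, h1]
  · intro o u hd hu
    by_cases hp : ∃ i, u ∈ (σ i).points
    -- The over strand lies in the disc as well, and the crossing is away from the ends, so nearby
    -- parameters on both sides stay in the strand and `g` governs the relation.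
    · obtain ⟨j, o₀, ho₀, hos⟩ := h.symm.mem_points_of_double (Double.symm hd) hp
      obtain ⟨i, t, ht, hst⟩ := hp
      have hd' : L'.Double ((σ j).pt o₀) ((σ i).pt t) := hd.congr hos.symm hst.symm
      have hta : (σ i).a < t := lt_of_le_of_ne ht.1 fun he => by
        subst he
        exact (hL' i _).1 hd'.symm
      have htb : t < (σ i).b := lt_of_le_of_ne ht.2 fun he => by
        subst he
        exact (hL' i _).2 hd'.symm
      refine ⟨(σ j).pt o₀, (σ i).pt t, hos.symm, hst.symm, ?_⟩
      change ∀ᶠ p in nhdsWithin t (Set.Iio t), ∀ᶠ q in nhdsWithin t (Set.Ioi t),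
        f' ((σ i).comp, q) = signedAct (L'.RightToLeft o u) (f' ((σ j).comp, o₀))
          (f' ((σ i).comp, p))
      filter_upwards [L'.eventually_clear_left (σ i).comp t, Ioo_mem_nhdsLT hta] with p h1 h2
      filter_upwards [L'.eventually_clear_right (σ i).comp t, Ioo_mem_nhdsGT htb] with q h3 h4
      have hpI : p ∈ Set.Icc (σ i).a (σ i).b := ⟨h2.1.le, (h2.2.trans htb).le⟩
      have hqI : q ∈ Set.Icc (σ i).a (σ i).b := ⟨(hta.trans h4.1).le, h4.2.le⟩
      rw [hApt i p hpI, hApt i q hqI, hApt j o₀ ho₀,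
        signedAct_congr (rightToLeft_congr hos.symm hst.symm)]
      exact (hg i).cross j o₀ t p q ho₀ hd' ((L'.under_same _ _ hst).2 hu) hpI hqI h2.2 h4.1 h1 h3
    · have hq : ¬ ∃ i, o ∈ (σ i).points := fun hq => hp (h.symm.mem_points_of_double hd hq)
      rw [not_exists] at hp hq
      refine ⟨o, u, LPt.Same.refl o, LPt.Same.refl u, ?_⟩
      have hev := hf.eventually_cross ((h.double_iff hq hp).1 hd) ((h.2.2.1 u hd.2.1 hp).2.1 hu)
      filter_upwards [hev, nhdsWithin_le_nhds (eventually_outside hp)] with p h1 h2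
      filter_upwards [h1, nhdsWithin_le_nhds (eventually_outside hp)] with q h3 h4
      rw [hB _ h2, hB _ h4, hB o hq, signedAct_congr (h.rightToLeft_iff hd.1 hd.2.1 hq hp), h3]
  · rintro p _ ⟨rfl, hp | ⟨i, rfl | rfl⟩⟩
    · exact (hB p hp).symm
    · rw [← ha i]
      exact (hApt i _ (Set.left_mem_Icc.2 (σ i).lt.le)).symm
    · rw [← hb i]
      exact (hApt i _ (Set.right_mem_Icc.2 (σ i).lt.le)).symm

/-- Starting from the outer colors at the initial ends, color the new strands. The common transfer
map makes their final colors equal to those of the old strands, so the result can be glued in; it is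
determined by its initial colors. -/
theorem LocalChange.transfers (h : LocalChange L L' σ) (hL : L.EndsSimple σ)
    (hL' : L'.EndsSimple σ) {F : (Fin r → X) → Fin r → X} (ht : L.HasTransfer σ F)
    (ht' : L'.HasTransfer σ F) : Transfers X (OuterRel σ) L L' where
  exists_coloring f hf := by
    obtain ⟨g, hg, hga⟩ := ht'.exists_coloring fun i => f ((σ i).pt (σ i).a)
    have hgb : ∀ i, g i (σ i).b = f ((σ i).pt (σ i).b) := fun i => by
      rw [ht'.final g hg, funext hga]
      exact (ht.final _ (hf.isStrandColoring σ) i).symm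
    obtain ⟨f', hf', hff'⟩ := h.exists_glue hL hL' hf hg hga hgb
    exact ⟨f', hf', fun p p' hp _ _ _ _ => hff' p p' hp⟩
  unique f g hf hg hfg p hv hu := by
    by_cases hp : ∃ i, p ∈ (σ i).points
    · obtain ⟨i, t, hti, hst⟩ := hp
      have htu : (σ i).pt t ∉ L'.under := fun h' => hu ((L'.under_same _ _ hst).1 h')
      rw [← hf.same _ _ hst ((σ i).valid_pt hti) htu, ← hg.same _ _ hst ((σ i).valid_pt hti) htu]
      refine ht'.unique _ _ (hf.isStrandColoring σ) (hg.isStrandColoring σ) (fun j => ?_) i t hti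
        htu
      have hv' := (σ j).valid_pt (Set.left_mem_Icc.2 (σ j).lt.le)
      exact hfg _ _ ⟨rfl, Or.inr ⟨j, Or.inl rfl⟩⟩ hv' hv' (hL.left_notMem j) (hL'.left_notMem j)
    · rw [not_exists] at hp
      exact hfg p p ⟨rfl, Or.inl hp⟩ hv hv (fun h' => hu ((h.2.2.1 p hv hp).2.2 h')) hu

theorem LocalChange.nonempty_coloringQuiver_iso {X : PointedQuandle.{u} (2 * n)}
    [Finite X.carrier] (S : Set X.End) (h : LocalChange L L' σ) (hL : L.EndsSimple σ)
    (hL' : L'.EndsSimple σ) {F : (Fin r → X.carrier) → Fin r → X.carrier}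
    (ht : L.HasTransfer σ F) (ht' : L'.HasTransfer σ F) :
    Nonempty ((coloringQuiver X S L).Iso (coloringQuiver X S L')) := by
  refine LinkoidDiagram.nonempty_coloringQuiver_iso S (T := OuterRel σ) (outerRel_endpoint σ)
    (h.transfers hL hL' ht ht') ?_
  rw [flip_outerRel]
  exact h.symm.transfers hL' hL ht' ht

end LinkoidDiagram

/-! # Colorings of strands -/

namespace LinkoidDiagram

variable {n m r : ℕ} {L L' : LinkoidDiagram n m} {σ : Fin r → LStrand n m}

/-- An under-crossing with two over points would be a triple point. -/
theorem over_unique (L : LinkoidDiagram n m)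
    (hdis : ∀ i j, i ≠ j → Disjoint (σ i).points (σ j).points) {u : LPt n m} {j j' : Fin r}
    {o o' : ℝ} (ho : o ∈ Set.Icc (σ j).a (σ j).b) (ho' : o' ∈ Set.Icc (σ j').a (σ j').b)
    (hd : L.Double ((σ j).pt o) u) (hd' : L.Double ((σ j').pt o') u) : j = j' ∧ o = o' :=
  pt_same_pt hdis ho ho' (L.no_triple u _ _ (Double.symm hd) (Double.symm hd'))

section

variable {X : Type u} [Quandle X] {g : Fin r → ℝ → X} {i : Fin r}

/-- This and the next two criteria, for zero, one or two under-crossings, replace the coloring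
conditions by explicit values in terms of the initial color and the over colors. Values at
under-crossings stay unconstrained. -/
theorem isStrandColoring_iff_of_clear
    (hu : ∀ t ∈ Set.Icc (σ i).a (σ i).b, (σ i).pt t ∉ L.under) :
    L.IsStrandColoring σ g i ↔ ∀ t ∈ Set.Icc (σ i).a (σ i).b, g i t = g i (σ i).a := by
  have hA : (σ i).a ∈ Set.Icc (σ i).a (σ i).b := Set.left_mem_Icc.2 (σ i).lt.le
  constructor
  · intro hg t ht
    exact hg.joined t ht _ hA fun s hs => hu s (Set.ordConnected_Icc.uIcc_subset ht hA hs)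
  · intro hg
    refine ⟨fun s hs t ht _ => (hg s hs).trans (hg t ht).symm, ?_⟩
    intro j o t p q _ _ htu hp hq hpt htq
    exact absurd htu (hu t ⟨hp.1.trans hpt.le, htq.le.trans hq.2⟩)

theorem isStrandColoring_iff_of_one
    (hdis : ∀ i j, i ≠ j → Disjoint (σ i).points (σ j).points) {u o : ℝ} {j : Fin r}
    (hui : u ∈ Set.Ioo (σ i).a (σ i).b) (ho : o ∈ Set.Icc (σ j).a (σ j).b)
    (hd : L.Double ((σ j).pt o) ((σ i).pt u)) (hun : (σ i).pt u ∈ L.under)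
    (hu : ∀ t ∈ Set.Icc (σ i).a (σ i).b, (σ i).pt t ∈ L.under → t = u) :
    L.IsStrandColoring σ g i ↔ ∀ t ∈ Set.Icc (σ i).a (σ i).b,
      (t < u → g i t = g i (σ i).a) ∧
      (u < t → g i t =
        signedAct (L.RightToLeft ((σ j).pt o) ((σ i).pt u)) (g j o) (g i (σ i).a)) := by
  have hA : (σ i).a ∈ Set.Icc (σ i).a (σ i).b := Set.left_mem_Icc.2 (σ i).lt.le
  constructor
  · intro hg t ht
    refine ⟨fun htu => ?_, fun htu => ?_⟩
    · refine hg.joined t ht _ hA fun s hs hsu => ?_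
      rw [Set.uIcc_of_ge ht.1] at hs
      have := hu s ⟨hs.1, hs.2.trans ht.2⟩ hsu
      linarith [hs.2]
    · refine hg.cross j o u _ t ho hd hun hA ht hui.1 htu (fun s hs hsu => ?_) fun s hs hsu => ?_
      · have := hu s ⟨hs.1, (hs.2.trans hui.2).le⟩ hsu
        linarith [hs.2]
      · have := hu s ⟨(hui.1.trans hs.1).le, hs.2.trans ht.2⟩ hsu
        linarith [hs.1]
  · intro hg
    refine ⟨fun s hs t ht hcl => ?_, ?_⟩
    -- A clear interval avoids `u`, so both of its ends lie on the same side of `u`.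
    · have hn : u ∉ Set.uIcc s t := fun h => hcl u h hun
      rw [Set.mem_uIcc, not_or, not_and_or, not_and_or] at hn
      simp only [not_le] at hn
      rcases lt_trichotomy s u with h | rfl | h
      · have ht' : t < u := by
          rcases hn.1 with h' | h'
          · linarith
          · exact h'
        rw [(hg s hs).1 h, (hg t ht).1 ht']
      · exact absurd hun (hcl _ Set.left_mem_uIcc)
      · have ht' : u < t := by
          rcases hn.2 with h' | h'
          · exact h'
          · linarith
        rw [(hg s hs).2 h, (hg t ht).2 ht']
    · intro j' o' t p q ho' hd' htu hp hq hpt htq _ _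
      obtain rfl := hu t ⟨hp.1.trans hpt.le, htq.le.trans hq.2⟩ htu
      obtain ⟨rfl, rfl⟩ := L.over_unique hdis ho ho' hd hd'
      rw [(hg p hp).1 hpt, (hg q hq).2 htq]

theorem isStrandColoring_iff_of_two
    (hdis : ∀ i j, i ≠ j → Disjoint (σ i).points (σ j).points) {u₁ u₂ o₁ o₂ : ℝ} {j₁ j₂ : Fin r}
    (h₁ : (σ i).a < u₁) (h₁₂ : u₁ < u₂) (h₂ : u₂ < (σ i).b)
    (ho₁ : o₁ ∈ Set.Icc (σ j₁).a (σ j₁).b) (ho₂ : o₂ ∈ Set.Icc (σ j₂).a (σ j₂).b)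
    (hd₁ : L.Double ((σ j₁).pt o₁) ((σ i).pt u₁)) (hd₂ : L.Double ((σ j₂).pt o₂) ((σ i).pt u₂))
    (hun₁ : (σ i).pt u₁ ∈ L.under) (hun₂ : (σ i).pt u₂ ∈ L.under)
    (hu : ∀ t ∈ Set.Icc (σ i).a (σ i).b, (σ i).pt t ∈ L.under → t = u₁ ∨ t = u₂) :
    L.IsStrandColoring σ g i ↔ ∀ t ∈ Set.Icc (σ i).a (σ i).b,
      (t < u₁ → g i t = g i (σ i).a) ∧
      (u₁ < t → t < u₂ → g i t =
        signedAct (L.RightToLeft ((σ j₁).pt o₁) ((σ i).pt u₁)) (g j₁ o₁) (g i (σ i).a)) ∧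
      (u₂ < t → g i t =
        signedAct (L.RightToLeft ((σ j₂).pt o₂) ((σ i).pt u₂)) (g j₂ o₂)
          (signedAct (L.RightToLeft ((σ j₁).pt o₁) ((σ i).pt u₁)) (g j₁ o₁)
            (g i (σ i).a))) := by
  have hA : (σ i).a ∈ Set.Icc (σ i).a (σ i).b := Set.left_mem_Icc.2 (σ i).lt.le
  constructor
  · intro hg
    have mid : ∀ t ∈ Set.Icc (σ i).a (σ i).b, u₁ < t → t < u₂ → g i t =
        signedAct (L.RightToLeft ((σ j₁).pt o₁) ((σ i).pt u₁)) (g j₁ o₁) (g i (σ i).a) := by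
      intro t ht ht1 ht2
      refine hg.cross j₁ o₁ u₁ _ t ho₁ hd₁ hun₁ hA ht h₁ ht1 (fun s hs hsu => ?_)
        fun s hs hsu => ?_
      · rcases hu s ⟨hs.1, by linarith [hs.2]⟩ hsu with h | h <;> linarith [hs.2]
      · rcases hu s ⟨(h₁.trans hs.1).le, hs.2.trans ht.2⟩ hsu with h | h <;>
          linarith [hs.1, hs.2]
    intro t ht
    refine ⟨fun htu => ?_, mid t ht, fun htu => ?_⟩
    · refine hg.joined t ht _ hA fun s hs hsu => ?_
      rw [Set.uIcc_of_ge ht.1] at hs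
      rcases hu s ⟨hs.1, hs.2.trans ht.2⟩ hsu with h | h <;> linarith [hs.2]
    -- The midpoint serves as a sample of the arc between the crossings: its color is the incoming
    -- color at the second one.
    · have hpI : (u₁ + u₂) / 2 ∈ Set.Icc (σ i).a (σ i).b := ⟨by linarith, by linarith⟩
      rw [← mid ((u₁ + u₂) / 2) hpI (by linarith) (by linarith)]
      refine hg.cross j₂ o₂ u₂ _ t ho₂ hd₂ hun₂ hpI ht (by linarith) htu (fun s hs hsu => ?_)
        fun s hs hsu => ?_
      · rcases hu s ⟨hpI.1.trans hs.1, by linarith [hs.2]⟩ hsu with h | h <;>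
          linarith [hs.1, hs.2]
      · rcases hu s ⟨by linarith [hs.1], hs.2.trans ht.2⟩ hsu with h | h <;> linarith [hs.1]
  · intro hg
    refine ⟨?_, ?_⟩
    · have key : ∀ s ∈ Set.Icc (σ i).a (σ i).b, ∀ t ∈ Set.Icc (σ i).a (σ i).b, s ≤ t →
          (∀ x ∈ Set.Icc s t, (σ i).pt x ∉ L.under) → g i s = g i t := by
        intro s hs t ht hst hcl
        have hn₁ : ¬ (s ≤ u₁ ∧ u₁ ≤ t) := fun h => hcl u₁ h hun₁
        have hn₂ : ¬ (s ≤ u₂ ∧ u₂ ≤ t) := fun h => hcl u₂ h hun₂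
        rw [not_and_or, not_le, not_le] at hn₁ hn₂
        rcases hn₁ with h | h
        · rcases hn₂ with h' | h'
          · rw [(hg s hs).2.2 h', (hg t ht).2.2 (h'.trans_le hst)]
          · rw [(hg s hs).2.1 h (hst.trans_lt h'), (hg t ht).2.1 (h.trans_le hst) h']
        · rw [(hg s hs).1 (hst.trans_lt h), (hg t ht).1 h]
      intro s hs t ht hcl
      rcases le_total s t with h | h
      · exact key s hs t ht h fun x hx => hcl x (Set.Icc_subset_uIcc hx)
      · exact (key t ht s hs h fun x hx => hcl x (Set.Icc_subset_uIcc' hx)).symm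
    · intro j' o' t p q ho' hd' htu hp hq hpt htq hclp hclq
      rcases hu t ⟨hp.1.trans hpt.le, htq.le.trans hq.2⟩ htu with rfl | rfl
      · obtain ⟨rfl, rfl⟩ := L.over_unique hdis ho₁ ho' hd₁ hd'
        have hq2 : q < u₂ := by
          by_contra h
          exact hclq u₂ ⟨h₁₂, not_lt.1 h⟩ hun₂
        rw [(hg p hp).1 hpt, (hg q hq).2.1 htq hq2]
      · obtain ⟨rfl, rfl⟩ := L.over_unique hdis ho₂ ho' hd₂ hd'
        have hp1 : u₁ < p := by
          by_contra h
          exact hclp u₁ ⟨not_lt.1 h, h₁₂⟩ hun₁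
        rw [(hg p hp).2.1 hp1 hpt, (hg q hq).2.2 htq]

end

/-! ## The crossings in a disc -/

theorem LocalChange.exists_crossing (h : LocalChange L L' σ) {C : Set (LPt n m × LPt n m)}
    (hC : L.OnlyCrossings σ C) {i : Fin r} {t : ℝ} (ht : t ∈ Set.Icc (σ i).a (σ i).b)
    {q : LPt n m} (hd : L.Double ((σ i).pt t) q) :
    ∃ c ∈ C, ((σ i).pt t).Same c.1 ∨ ((σ i).pt t).Same c.2 := by
  have hp : ∃ i', (σ i).pt t ∈ (σ i').points := ⟨i, (σ i).pt_mem_points ht⟩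
  obtain ⟨c, hc, h | h⟩ := hC _ q hp (h.mem_points_of_double hd hp) hd
  · exact ⟨c, hc, Or.inl h.1⟩
  · exact ⟨c, hc, Or.inr h.2⟩

/-- All crossings of the strands are among the listed ones, which have interior parameters, and a
point of the strands has only one strand and parameter. -/
theorem LocalChange.endsSimple (h : LocalChange L L' σ) {C : Set (LPt n m × LPt n m)}
    (hC : L.OnlyCrossings σ C)
    (hint : ∀ c ∈ C, (∃ i, ∃ s ∈ Set.Ioo (σ i).a (σ i).b, c.1 = (σ i).pt s) ∧
      ∃ i, ∃ s ∈ Set.Ioo (σ i).a (σ i).b, c.2 = (σ i).pt s) : L.EndsSimple σ := by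
  have key : ∀ i, ∀ t ∈ Set.Icc (σ i).a (σ i).b, ∀ q, L.Double ((σ i).pt t) q →
      t ∈ Set.Ioo (σ i).a (σ i).b := by
    intro i t ht q hd
    obtain ⟨c, hc, hs⟩ := h.exists_crossing hC ht hd
    obtain ⟨j, s, hsI, hs'⟩ : ∃ j, ∃ s ∈ Set.Ioo (σ j).a (σ j).b,
        ((σ i).pt t).Same ((σ j).pt s) := by
      rcases hs with hs | hs
      · obtain ⟨j, s, hsI, he⟩ := (hint c hc).1
        exact ⟨j, s, hsI, he ▸ hs⟩
      · obtain ⟨j, s, hsI, he⟩ := (hint c hc).2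
        exact ⟨j, s, hsI, he ▸ hs⟩
    obtain ⟨rfl, rfl⟩ := pt_same_pt h.1 ht (Set.Ioo_subset_Icc_self hsI) hs'
    exact hsI
  refine fun i q => ⟨fun hd => ?_, fun hd => ?_⟩
  · exact lt_irrefl _ (key i _ (Set.left_mem_Icc.2 (σ i).lt.le) q hd).1
  · exact lt_irrefl _ (key i _ (Set.right_mem_Icc.2 (σ i).lt.le) q hd).2

theorem LocalChange.clear_of_onlyCrossings_empty (h : LocalChange L L' σ)
    (hC : L.OnlyCrossings σ ∅) (i : Fin r) (t : ℝ) (ht : t ∈ Set.Icc (σ i).a (σ i).b) :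
    (σ i).pt t ∉ L.under := fun hu => by
  obtain ⟨q, hq⟩ := L.under_double _ hu
  obtain ⟨c, hc, -⟩ := h.exists_crossing hC ht hq
  exact hc

variable {X : Type u} [Quandle X]

theorem LocalChange.hasTransfer_of_onlyCrossings_empty (h : LocalChange L L' σ)
    (hC : L.OnlyCrossings σ ∅) : L.HasTransfer (X := X) σ id where
  exists_coloring x := ⟨fun i _ => x i, fun i =>
    (isStrandColoring_iff_of_clear (h.clear_of_onlyCrossings_empty hC i)).2 fun _ _ => rfl,
    fun _ => rfl⟩
  final g hg i := (isStrandColoring_iff_of_clear (h.clear_of_onlyCrossings_empty hC i)).1 (hg i) _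
    (Set.right_mem_Icc.2 (σ i).lt.le)
  unique g g' hg hg' hgg' i t ht _ := by
    have hcl := h.clear_of_onlyCrossings_empty hC i
    rw [(isStrandColoring_iff_of_clear hcl).1 (hg i) t ht,
      (isStrandColoring_iff_of_clear hcl).1 (hg' i) t ht, hgg']

/-- A kink does not change the color of a strand. -/
theorem hasTransfer_kink {σ : Fin 1 → LStrand n m} {o u : ℝ}
    (ho : o ∈ Set.Ioo (σ 0).a (σ 0).b) (hui : u ∈ Set.Ioo (σ 0).a (σ 0).b)
    (hd : L.Double ((σ 0).pt o) ((σ 0).pt u)) (hun : (σ 0).pt u ∈ L.under)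
    (hu : ∀ t ∈ Set.Icc (σ 0).a (σ 0).b, (σ 0).pt t ∈ L.under → t = u) :
    L.HasTransfer (X := X) σ id := by
  have hdis : ∀ i j, i ≠ j → Disjoint (σ i).points (σ j).points :=
    fun i j hij => absurd (Subsingleton.elim i j) hij
  have hoI := Set.Ioo_subset_Icc_self ho
  have hou : o ≠ u := fun h => hd.2.2.1 (h ▸ LPt.Same.refl _)
  have iff (g : Fin 1 → ℝ → X) :=
    isStrandColoring_iff_of_one (g := g) hdis hui hoI hd hun hu
  have const : ∀ g : Fin 1 → ℝ → X, (∀ i, L.IsStrandColoring σ g i) →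
      ∀ t ∈ Set.Icc (σ 0).a (σ 0).b, (σ 0).pt t ∉ L.under → g 0 t = g 0 (σ 0).a := by
    intro g hg t ht htu
    have H := (iff g).1 (hg 0)
    -- If the strand passes over itself first, the over color is the initial color. Otherwise the
    -- over color `c` is the signed action of `c` on the initial color; also `c` acts on itself
    -- trivially, so injectivity gives the equality.
    have hoa : g 0 o = g 0 (σ 0).a := by
      rcases lt_or_gt_of_ne hou with h | h
      · exact (H o hoI).1 h
      · have h2 := (H o hoI).2 h
        refine signedAct_injective (L.RightToLeft ((σ 0).pt o) ((σ 0).pt u)) (g 0 o) ?_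
        rw [← h2, signedAct_self]
    rcases lt_trichotomy t u with h | rfl | h
    · exact (H t ht).1 h
    · exact absurd hun htu
    · rw [(H t ht).2 h, hoa, signedAct_self]
  have hb : (σ 0).b ∈ Set.Icc (σ 0).a (σ 0).b := Set.right_mem_Icc.2 (σ 0).lt.le
  refine ⟨fun x => ⟨fun i _ => x i, fun i => ?_, fun _ => rfl⟩, fun g hg i => ?_,
    fun g g' hg hg' hgg' i t ht htu => ?_⟩
  · obtain rfl := Subsingleton.elim i 0
    exact (iff _).2 fun t _ => ⟨fun _ => rfl, fun _ => (signedAct_self _ _).symm⟩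
  · obtain rfl := Subsingleton.elim i 0
    exact const g hg _ hb fun h => hui.2.ne (hu _ hb h).symm
  · obtain rfl := Subsingleton.elim i 0
    rw [const g hg t ht htu, const g' hg' t ht htu, hgg']

/-- A strand that passes below another one twice, with opposite signs, keeps its color. -/
theorem hasTransfer_bigon {σ : Fin 2 → LStrand n m}
    (hdis : ∀ i j, i ≠ j → Disjoint (σ i).points (σ j).points) {o₁ o₂ u₁ u₂ : ℝ}
    (ho₁ : o₁ ∈ Set.Icc (σ 0).a (σ 0).b) (ho₂ : o₂ ∈ Set.Icc (σ 0).a (σ 0).b)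
    (h₁ : (σ 1).a < u₁) (h₁₂ : u₁ < u₂) (h₂ : u₂ < (σ 1).b)
    (hd₁ : L.Double ((σ 0).pt o₁) ((σ 1).pt u₁)) (hd₂ : L.Double ((σ 0).pt o₂) ((σ 1).pt u₂))
    (hun₁ : (σ 1).pt u₁ ∈ L.under) (hun₂ : (σ 1).pt u₂ ∈ L.under)
    (hsign : L.RightToLeft ((σ 0).pt o₂) ((σ 1).pt u₂) ↔
      ¬ L.RightToLeft ((σ 0).pt o₁) ((σ 1).pt u₁))
    (hu₀ : ∀ t ∈ Set.Icc (σ 0).a (σ 0).b, (σ 0).pt t ∉ L.under)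
    (hu : ∀ t ∈ Set.Icc (σ 1).a (σ 1).b, (σ 1).pt t ∈ L.under → t = u₁ ∨ t = u₂) :
    L.HasTransfer (X := X) σ id := by
  have iff₀ (g : Fin 2 → ℝ → X) := isStrandColoring_iff_of_clear (g := g) hu₀
  have iff₁ (g : Fin 2 → ℝ → X) :=
    isStrandColoring_iff_of_two (g := g) hdis h₁ h₁₂ h₂ ho₁ ho₂ hd₁ hd₂ hun₁ hun₂ hu
  have hA : (σ 1).a ∈ Set.Icc (σ 1).a (σ 1).b := Set.left_mem_Icc.2 (σ 1).lt.le
  refine ⟨fun x => ?_, fun g hg => ?_, fun g g' hg hg' hgg' => ?_⟩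
  -- The lower strand changes color between the two crossings and the opposite action restores it.
  · refine ⟨![fun _ => x 0, fun t => if t < u₁ then x 1 else if t < u₂ then
      signedAct (L.RightToLeft ((σ 0).pt o₁) ((σ 1).pt u₁)) (x 0) (x 1) else x 1], ?_, ?_⟩
    · rw [Fin.forall_fin_two, iff₀, iff₁]
      refine ⟨fun _ _ => rfl, fun t _ => ⟨fun h => ?_, fun h h' => ?_, fun h => ?_⟩⟩
      · simp [h, h₁]
      · simp [h.not_gt, h', h₁]
      · simp [h.not_gt, (h₁₂.trans h).not_gt, h₁, signedAct_signedAct_of_not hsign]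
    · rw [Fin.forall_fin_two]
      exact ⟨rfl, if_pos h₁⟩
  · have H₀ := (iff₀ g).1 (hg 0)
    have H₁ := (iff₁ g).1 (hg 1)
    rw [Fin.forall_fin_two]
    refine ⟨H₀ _ (Set.right_mem_Icc.2 (σ 0).lt.le), ?_⟩
    rw [(H₁ _ (Set.right_mem_Icc.2 (σ 1).lt.le)).2.2 h₂, H₀ o₁ ho₁, H₀ o₂ ho₂,
      signedAct_signedAct_of_not hsign]
    rfl
  · have H₀ := (iff₀ g).1 (hg 0)
    have H₁ := (iff₁ g).1 (hg 1)
    have H₀' := (iff₀ g').1 (hg' 0)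
    have H₁' := (iff₁ g').1 (hg' 1)
    rw [Fin.forall_fin_two]
    refine ⟨fun t ht _ => by rw [H₀ t ht, H₀' t ht, hgg'], fun t ht htu => ?_⟩
    rcases lt_trichotomy t u₁ with h | rfl | h
    · rw [(H₁ t ht).1 h, (H₁' t ht).1 h, hgg']
    · exact absurd hun₁ htu
    · rcases lt_trichotomy t u₂ with h' | rfl | h'
      · rw [(H₁ t ht).2.1 h h', (H₁' t ht).2.1 h h', H₀ o₁ ho₁, H₀' o₁ ho₁, hgg', hgg']
      · exact absurd hun₂ htu
      · rw [(H₁ t ht).2.2 h', (H₁' t ht).2.2 h', H₀ o₁ ho₁, H₀' o₁ ho₁, H₀ o₂ ho₂, H₀' o₂ ho₂,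
          hgg', hgg']

/-- Three strands, of which strand `0` passes over strand `1` at its parameter `u`, and strand `2`
passes below the strands `j₁` and `j₂` at its parameters `u₁` and `u₂`, where these strands have
colors given by `G₁` and `G₂`. -/
theorem hasTransfer_three {σ : Fin 3 → LStrand n m}
    (hdis : ∀ i j, i ≠ j → Disjoint (σ i).points (σ j).points) {o u o₁ o₂ u₁ u₂ : ℝ}
    {j₁ j₂ : Fin 3} (ho : o ∈ Set.Icc (σ 0).a (σ 0).b) (hui : u ∈ Set.Ioo (σ 1).a (σ 1).b)
    (ho₁ : o₁ ∈ Set.Icc (σ j₁).a (σ j₁).b) (ho₂ : o₂ ∈ Set.Icc (σ j₂).a (σ j₂).b)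
    (h₁ : (σ 2).a < u₁) (h₁₂ : u₁ < u₂) (h₂ : u₂ < (σ 2).b)
    (hd : L.Double ((σ 0).pt o) ((σ 1).pt u))
    (hd₁ : L.Double ((σ j₁).pt o₁) ((σ 2).pt u₁)) (hd₂ : L.Double ((σ j₂).pt o₂) ((σ 2).pt u₂))
    (hun : (σ 1).pt u ∈ L.under) (hun₁ : (σ 2).pt u₁ ∈ L.under) (hun₂ : (σ 2).pt u₂ ∈ L.under)
    (hcl₀ : ∀ t ∈ Set.Icc (σ 0).a (σ 0).b, (σ 0).pt t ∉ L.under)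
    (hcl₁ : ∀ t ∈ Set.Icc (σ 1).a (σ 1).b, (σ 1).pt t ∈ L.under → t = u)
    (hcl₂ : ∀ t ∈ Set.Icc (σ 2).a (σ 2).b, (σ 2).pt t ∈ L.under → t = u₁ ∨ t = u₂)
    {P P₁ P₂ : Prop} (hP : P ↔ L.RightToLeft ((σ 0).pt o) ((σ 1).pt u))
    (hP₁ : P₁ ↔ L.RightToLeft ((σ j₁).pt o₁) ((σ 2).pt u₁))
    (hP₂ : P₂ ↔ L.RightToLeft ((σ j₂).pt o₂) ((σ 2).pt u₂)) (G₁ G₂ : X → X → X)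
    (hG₁ : ∀ g : Fin 3 → ℝ → X, L.IsStrandColoring σ g 0 → L.IsStrandColoring σ g 1 →
      g j₁ o₁ = G₁ (g 0 (σ 0).a) (g 1 (σ 1).a))
    (hG₂ : ∀ g : Fin 3 → ℝ → X, L.IsStrandColoring σ g 0 → L.IsStrandColoring σ g 1 →
      g j₂ o₂ = G₂ (g 0 (σ 0).a) (g 1 (σ 1).a)) :
    L.HasTransfer σ fun x : Fin 3 → X => ![x 0, signedAct P (x 0) (x 1),
      signedAct P₂ (G₂ (x 0) (x 1)) (signedAct P₁ (G₁ (x 0) (x 1)) (x 2))] := by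
  have iff₀ (g : Fin 3 → ℝ → X) := isStrandColoring_iff_of_clear (g := g) hcl₀
  have iff₁ (g : Fin 3 → ℝ → X) := isStrandColoring_iff_of_one (g := g) hdis hui ho hd hun hcl₁
  have iff₂ (g : Fin 3 → ℝ → X) :=
    isStrandColoring_iff_of_two (g := g) hdis h₁ h₁₂ h₂ ho₁ ho₂ hd₁ hd₂ hun₁ hun₂ hcl₂
  simp only [← propext hP] at iff₁
  simp only [← propext hP₁, ← propext hP₂] at iff₂
  refine ⟨fun x => ?_, fun g hg => ?_, fun g g' hg hg' hgg' => ?_⟩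
  · let g : Fin 3 → ℝ → X := ![fun _ => x 0, fun t => if t < u then x 1 else
      signedAct P (x 0) (x 1), fun t => if t < u₁ then x 2 else if t < u₂ then
      signedAct P₁ (G₁ (x 0) (x 1)) (x 2) else
      signedAct P₂ (G₂ (x 0) (x 1)) (signedAct P₁ (G₁ (x 0) (x 1)) (x 2))]
    have ga : ∀ i, g i (σ i).a = x i := by
      rw [Fin.forall_fin_succ, Fin.forall_fin_two]
      exact ⟨rfl, if_pos hui.1, if_pos h₁⟩
    have hg₀ : L.IsStrandColoring σ g 0 := (iff₀ g).2 fun _ _ => rfl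
    have hg₁ : L.IsStrandColoring σ g 1 := (iff₁ g).2 fun t _ =>
      ⟨fun h => (if_pos h).trans (ga 1).symm, fun h => by
        rw [ga 1]
        exact if_neg h.not_gt⟩
    refine ⟨g, ?_, ga⟩
    rw [Fin.forall_fin_succ, Fin.forall_fin_two]
    refine ⟨hg₀, hg₁, (iff₂ g).2 fun t _ => ?_⟩
    -- The hypotheses on `G₁` and `G₂` ask only for strands `0` and `1` to be colored correctly, so
    -- they already apply while strand `2` is being checked.
    rw [hG₁ g hg₀ hg₁, hG₂ g hg₀ hg₁, ga, ga, ga]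
    refine ⟨fun h => if_pos h, fun h h' => ?_, fun h => ?_⟩
    · exact (if_neg h.not_gt).trans (if_pos h')
    · exact (if_neg (h₁₂.trans h).not_gt).trans (if_neg h.not_gt)
  · have H₀ := (iff₀ g).1 (hg 0)
    rw [Fin.forall_fin_succ, Fin.forall_fin_two]
    refine ⟨H₀ _ (Set.right_mem_Icc.2 (σ 0).lt.le), ?_, ?_⟩
    · have := ((iff₁ g).1 (hg 1) _ (Set.right_mem_Icc.2 (σ 1).lt.le)).2 hui.2
      rwa [H₀ o ho] at this
    · have := ((iff₂ g).1 (hg 2) _ (Set.right_mem_Icc.2 (σ 2).lt.le)).2.2 h₂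
      rwa [hG₁ g (hg 0) (hg 1), hG₂ g (hg 0) (hg 1)] at this
  · have H₀ := (iff₀ g).1 (hg 0)
    have H₁ := (iff₁ g).1 (hg 1)
    have H₂ := (iff₂ g).1 (hg 2)
    have H₀' := (iff₀ g').1 (hg' 0)
    have H₁' := (iff₁ g').1 (hg' 1)
    have H₂' := (iff₂ g').1 (hg' 2)
    rw [hG₁ g (hg 0) (hg 1), hG₂ g (hg 0) (hg 1), hgg', hgg', hgg'] at H₂
    rw [hG₁ g' (hg' 0) (hg' 1), hG₂ g' (hg' 0) (hg' 1)] at H₂'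
    rw [H₀ o ho, hgg', hgg'] at H₁
    rw [H₀' o ho] at H₁'
    rw [Fin.forall_fin_succ, Fin.forall_fin_two]
    refine ⟨fun t ht _ => by rw [H₀ t ht, H₀' t ht, hgg'], fun t ht htu => ?_, fun t ht htu => ?_⟩
    · change g 1 t = g' 1 t
      rcases lt_trichotomy t u with h | rfl | h
      · rw [(H₁ t ht).1 h, (H₁' t ht).1 h]
      · exact absurd hun htu
      · rw [(H₁ t ht).2 h, (H₁' t ht).2 h]
    · change g 2 t = g' 2 t
      rcases lt_trichotomy t u₁ with h | rfl | h
      · rw [(H₂ t ht).1 h, (H₂' t ht).1 h]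
      · exact absurd hun₁ htu
      · rcases lt_trichotomy t u₂ with h' | rfl | h'
        · rw [(H₂ t ht).2.1 h h', (H₂' t ht).2.1 h h']
        · exact absurd hun₂ htu
        · rw [(H₂ t ht).2.2 h', (H₂' t ht).2.2 h']

/-! ## Triangles -/

open Classical in
/-- The final colors of a triangle of strands: `P₀₁`, `P₀₂`, `P₁₂` are the signs of the crossings,
`A` holds if strand `2` meets strand `0` before strand `1`, and `B` holds if strand `1` meets
strand `2` before strand `0`. -/
noncomputable def triangleMap (P₀₁ P₀₂ P₁₂ A B : Prop) (x : Fin 3 → X) : Fin 3 → X :=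
  let M := if B then x 1 else signedAct P₀₁ (x 0) (x 1)
  ![x 0, signedAct P₀₁ (x 0) (x 1), if A then signedAct P₁₂ M (signedAct P₀₂ (x 0) (x 2))
    else signedAct P₀₂ (x 0) (signedAct P₁₂ M (x 2))]

/-- Moving the action of `x 0` past that of the middle strand replaces the middle color by its image
under the `P₀₂` action. The reversal swaps `x 1` with its `P₀₁` image as middle color. With equal
signs the `P₀₂` action takes `x 1` to that image, with opposite signs it takes the image back to `x
1`; the hypothesis says that the direction needed is the one that occurs. -/
theorem triangleMap_not {P₀₁ P₀₂ P₁₂ A B : Prop} (h : (P₀₁ ↔ P₀₂) ↔ (B ↔ ¬ A)) :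
    triangleMap (X := X) P₀₁ P₀₂ P₁₂ (¬ A) (¬ B) = triangleMap P₀₁ P₀₂ P₁₂ A B := by
  funext x
  have same : (P₀₁ ↔ P₀₂) → signedAct P₀₂ (x 0) (x 1) = signedAct P₀₁ (x 0) (x 1) :=
    fun h => signedAct_congr h.symm _ _
  have opp : ¬ (P₀₁ ↔ P₀₂) → signedAct P₀₂ (x 0) (signedAct P₀₁ (x 0) (x 1)) = x 1 :=
    fun h => signedAct_signedAct_of_not (by tauto) _ _
  by_cases hA : A <;> by_cases hB : B <;> simp only [hA, hB, triangleMap, not_true_eq_false,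
    not_false_eq_true, if_true, if_false, iff_true, iff_false, iff_self] at h ⊢
  · rw [signedAct_distrib P₀₂ P₁₂ (x 0), opp h]
  · rw [signedAct_distrib P₀₂ P₁₂ (x 0), same h]
  · rw [signedAct_distrib P₀₂ P₁₂ (x 0), same h]
  · rw [signedAct_distrib P₀₂ P₁₂ (x 0), opp h]

section Triangle

variable {σ : Fin 3 → LStrand n m} {s : Fin 3 → Fin 3 → ℝ}

/-- Equal parameters would put points of three strands over one position, which is excluded. -/
theorem Triangle.ne (hT : L.Triangle σ s)
    (hdis : ∀ i j, i ≠ j → Disjoint (σ i).points (σ j).points) {i j k : Fin 3} (hij : i ≠ j)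
    (hik : i ≠ k) (hjk : j ≠ k) : s i j ≠ s i k := fun he => by
  have h1 := (hT.1 i j hij).2
  have h2 := (hT.1 i k hik).2
  rw [← he] at h2
  exact hjk (pt_same_pt hdis (Set.Ioo_subset_Icc_self (hT.1 j i hij.symm).1)
    (Set.Ioo_subset_Icc_self (hT.1 k i hik.symm).1) (L.no_triple _ _ _ h1 h2)).1

theorem Triangle.eq_of_mem_under (hT : L.Triangle σ s) (h : LocalChange L L' σ) {k : Fin 3}
    {t : ℝ} (ht : t ∈ Set.Icc (σ k).a (σ k).b) (hu : (σ k).pt t ∈ L.under) :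
    ∃ i, i < k ∧ t = s k i := by
  obtain ⟨q, hq⟩ := L.under_double _ hu
  obtain ⟨_, ⟨i, j, hij, rfl⟩, hs | hs⟩ := h.exists_crossing hT.2.2.1 ht hq
  · exfalso
    have hd := (hT.1 i j hij.ne).2
    exact hd.over_notMem (hT.2.1 i j hij) ((L.under_same _ _ hs).1 hu)
  · obtain ⟨rfl, rfl⟩ := pt_same_pt h.1 ht (Set.Ioo_subset_Icc_self (hT.1 j i hij.ne').1) hs
    exact ⟨i, hij, rfl⟩

theorem Triangle.endsSimple (hT : L.Triangle σ s) (h : LocalChange L L' σ) : L.EndsSimple σ := by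
  refine h.endsSimple hT.2.2.1 ?_
  rintro _ ⟨i, j, hij, rfl⟩
  exact ⟨⟨i, _, (hT.1 i j hij.ne).1, rfl⟩, ⟨j, _, (hT.1 j i hij.ne').1, rfl⟩⟩

/-- Strand `0` is never under, strand `1` only under strand `0`, and strand `2` under both. The
color strand `1` shows to strand `2` depends on whether that meeting comes before its passage under
strand `0`; the two orders along strand `2` are instances of one lemma. -/
theorem Triangle.hasTransfer (hT : L.Triangle σ s) (h : LocalChange L L' σ) :
    L.HasTransfer (X := X) σ (triangleMap
      (L.RightToLeft ((σ 0).pt (s 0 1)) ((σ 1).pt (s 1 0)))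
      (L.RightToLeft ((σ 0).pt (s 0 2)) ((σ 2).pt (s 2 0)))
      (L.RightToLeft ((σ 1).pt (s 1 2)) ((σ 2).pt (s 2 1)))
      (s 2 0 < s 2 1) (s 1 2 < s 1 0)) := by
  classical
  have d01 := hT.1 0 1 (by decide)
  have d10 := hT.1 1 0 (by decide)
  have d02 := hT.1 0 2 (by decide)
  have d20 := hT.1 2 0 (by decide)
  have d12 := hT.1 1 2 (by decide)
  have d21 := hT.1 2 1 (by decide)
  have u1 := hT.2.1 0 1 (by decide)
  have u2 := hT.2.1 0 2 (by decide)
  have u3 := hT.2.1 1 2 (by decide)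
  have hcl₀ : ∀ t ∈ Set.Icc (σ 0).a (σ 0).b, (σ 0).pt t ∉ L.under := fun t ht hu => by
    obtain ⟨i, hi, -⟩ := hT.eq_of_mem_under h ht hu
    exact absurd hi (Fin.not_lt_zero i)
  have hcl₁ : ∀ t ∈ Set.Icc (σ 1).a (σ 1).b, (σ 1).pt t ∈ L.under → t = s 1 0 := by
    intro t ht hu
    obtain ⟨i, hi, rfl⟩ := hT.eq_of_mem_under h ht hu
    obtain rfl : i = 0 := by omega
    rfl
  have hcl₂ : ∀ t ∈ Set.Icc (σ 2).a (σ 2).b, (σ 2).pt t ∈ L.under → t = s 2 0 ∨ t = s 2 1 := by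
    intro t ht hu
    obtain ⟨i, hi, rfl⟩ := hT.eq_of_mem_under h ht hu
    obtain rfl | rfl : i = 0 ∨ i = 1 := by omega
    · exact Or.inl rfl
    · exact Or.inr rfl
  have i01 := Set.Ioo_subset_Icc_self d01.1
  have i02 := Set.Ioo_subset_Icc_self d02.1
  have i12 := Set.Ioo_subset_Icc_self d12.1
  have G0 : ∀ g : Fin 3 → ℝ → X, L.IsStrandColoring σ g 0 → ∀ t ∈ Set.Icc (σ 0).a (σ 0).b,
      g 0 t = g 0 (σ 0).a := fun g hg => (isStrandColoring_iff_of_clear hcl₀).1 hg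
  have G1 : ∀ g : Fin 3 → ℝ → X, L.IsStrandColoring σ g 0 → L.IsStrandColoring σ g 1 →
      g 1 (s 1 2) = if s 1 2 < s 1 0 then g 1 (σ 1).a else
        signedAct (L.RightToLeft ((σ 0).pt (s 0 1)) ((σ 1).pt (s 1 0))) (g 0 (σ 0).a)
          (g 1 (σ 1).a) := by
    intro g hg₀ hg₁
    have H := (isStrandColoring_iff_of_one h.1 d10.1 i01 d01.2 u1 hcl₁).1 hg₁ _ i12
    split_ifs with hlt
    · exact H.1 hlt
    · rw [H.2 (lt_of_le_of_ne (not_lt.1 hlt)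
        (hT.ne h.1 (by decide) (by decide) (by decide))), G0 g hg₀ _ i01]
  by_cases hA : s 2 0 < s 2 1
  · have := hasTransfer_three h.1 i01 d10.1 i02 i12 d20.1.1 hA d21.1.2 d01.2 d02.2 d12.2 u1 u2 u3
      hcl₀ hcl₁ hcl₂ Iff.rfl Iff.rfl Iff.rfl (fun a _ => a) (fun a b =>
        if s 1 2 < s 1 0 then b else
          signedAct (L.RightToLeft ((σ 0).pt (s 0 1)) ((σ 1).pt (s 1 0))) a b)
      (fun g hg _ => G0 g hg _ i02) G1
    convert this using 1
    funext x
    simp only [triangleMap, if_pos hA]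
  · have hA' : s 2 1 < s 2 0 := lt_of_le_of_ne (not_lt.1 hA)
      (hT.ne h.1 (by decide) (by decide) (by decide))
    have := hasTransfer_three h.1 i01 d10.1 i12 i02 d21.1.1 hA' d20.1.2 d01.2 d12.2 d02.2 u1 u3 u2
      hcl₀ hcl₁ (fun t ht hu => (hcl₂ t ht hu).symm) Iff.rfl Iff.rfl Iff.rfl
      (fun a b =>
        if s 1 2 < s 1 0 then b else
          signedAct (L.RightToLeft ((σ 0).pt (s 0 1)) ((σ 1).pt (s 1 0))) a b) (fun a _ => a) G1
      (fun g hg _ => G0 g hg _ i02)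
    convert this using 1
    funext x
    simp only [triangleMap, if_neg hA]

end Triangle

/-! # Invariance of the quiver -/

section

variable {X : PointedQuandle.{u} (2 * n)} [Finite X.carrier] (S : Set X.End)

theorem SMove.nonempty_coloringQuiver_iso (h : SMove L L') :
    Nonempty ((coloringQuiver X S L).Iso (coloringQuiver X S L')) := by
  obtain ⟨σ, hloc, hC, hC'⟩ := h
  exact hloc.nonempty_coloringQuiver_iso S (hloc.endsSimple hC fun _ hc => absurd hc id)
    (hloc.symm.endsSimple hC' fun _ hc => absurd hc id)
    (hloc.hasTransfer_of_onlyCrossings_empty hC) (hloc.symm.hasTransfer_of_onlyCrossings_empty hC')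

theorem Reidemeister1.nonempty_coloringQuiver_iso (h : Reidemeister1 L L') :
    Nonempty ((coloringQuiver X S L).Iso (coloringQuiver X S L')) := by
  obtain ⟨σ, hloc, hC, s, t, has, hst, htb, hd, hC'⟩ := h
  have hs : s ∈ Set.Ioo (σ 0).a (σ 0).b := ⟨has, hst.trans htb⟩
  have ht : t ∈ Set.Ioo (σ 0).a (σ 0).b := ⟨has.trans hst, htb⟩
  have hends : L'.EndsSimple σ := hloc.symm.endsSimple hC' fun c hc => by
    rw [Set.mem_singleton_iff] at hc
    subst hc
    exact ⟨⟨0, s, hs, rfl⟩, ⟨0, t, ht, rfl⟩⟩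
  have hun : ∀ x ∈ Set.Icc (σ 0).a (σ 0).b, (σ 0).pt x ∈ L'.under → x = s ∨ x = t := by
    intro x hx hu
    obtain ⟨q, hq⟩ := L'.under_double _ hu
    obtain ⟨c, hc, hxc⟩ := hloc.symm.exists_crossing hC' hx hq
    rw [Set.mem_singleton_iff] at hc
    subst hc
    rcases hxc with hxc | hxc
    · exact Or.inl (((σ 0).pt_same_pt_iff hx (Set.Ioo_subset_Icc_self hs)).1 hxc)
    · exact Or.inr (((σ 0).pt_same_pt_iff hx (Set.Ioo_subset_Icc_self ht)).1 hxc)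
  refine hloc.nonempty_coloringQuiver_iso S (hloc.endsSimple hC fun _ hc => absurd hc id) hends
    (hloc.hasTransfer_of_onlyCrossings_empty hC) ?_
  -- Both kinds of kink occur: the under-crossing is either the second or the first passage through
  -- the double point.
  by_cases htu : (σ 0).pt t ∈ L'.under
  · refine hasTransfer_kink hs ht hd htu fun x hx hu => ?_
    rcases hun x hx hu with rfl | rfl
    · exact absurd hu (hd.over_notMem htu)
    · rfl
  · have hsu : (σ 0).pt s ∈ L'.under := (L'.under_iff _ _ hd).2 htu
    refine hasTransfer_kink ht hs hd.symm hsu fun x hx hu => ?_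
    rcases hun x hx hu with rfl | rfl
    · rfl
    · exact absurd hu htu

theorem Reidemeister2.nonempty_coloringQuiver_iso (h : Reidemeister2 L L') :
    Nonempty ((coloringQuiver X S L).Iso (coloringQuiver X S L')) := by
  obtain ⟨σ, hloc, hC, s₁, s₂, t₁, t₂, hs₁, hs₂, -, ht₁, ht₂, hne, hd₁, hd₂, hu₁, hu₂, hsign,
    hC'⟩ := h
  have hdis := hloc.1
  have is₁ := Set.Ioo_subset_Icc_self hs₁
  have is₂ := Set.Ioo_subset_Icc_self hs₂
  have it₁ := Set.Ioo_subset_Icc_self ht₁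
  have it₂ := Set.Ioo_subset_Icc_self ht₂
  have hends : L'.EndsSimple σ := hloc.symm.endsSimple hC' fun c hc => by
    rcases hc with rfl | rfl
    · exact ⟨⟨0, s₁, hs₁, rfl⟩, ⟨1, t₁, ht₁, rfl⟩⟩
    · exact ⟨⟨0, s₂, hs₂, rfl⟩, ⟨1, t₂, ht₂, rfl⟩⟩
  have hun : ∀ i, ∀ x ∈ Set.Icc (σ i).a (σ i).b, (σ i).pt x ∈ L'.under →
      i = 1 ∧ (x = t₁ ∨ x = t₂) := by
    intro i x hx hu
    obtain ⟨q, hq⟩ := L'.under_double _ hu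
    obtain ⟨c, rfl | rfl, hxc | hxc⟩ := hloc.symm.exists_crossing hC' hx hq
    · exact absurd ((L'.under_same _ _ hxc).1 hu) (hd₁.over_notMem hu₁)
    · obtain ⟨rfl, rfl⟩ := pt_same_pt hdis hx it₁ hxc
      exact ⟨rfl, Or.inl rfl⟩
    · exact absurd ((L'.under_same _ _ hxc).1 hu) (hd₂.over_notMem hu₂)
    · obtain ⟨rfl, rfl⟩ := pt_same_pt hdis hx it₂ hxc
      exact ⟨rfl, Or.inr rfl⟩
  refine hloc.nonempty_coloringQuiver_iso S (hloc.endsSimple hC fun _ hc => absurd hc id) hends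
    (hloc.hasTransfer_of_onlyCrossings_empty hC) ?_
  have hun₀ : ∀ x ∈ Set.Icc (σ 0).a (σ 0).b, (σ 0).pt x ∉ L'.under := fun x hx hu =>
    absurd (hun 0 x hx hu).1 (by decide)
  have hun₁ := fun x hx hu => (hun 1 x hx hu).2
  -- The strands may run in parallel or in opposite directions, so the crossings are sorted along
  -- the lower strand.
  rcases lt_or_gt_of_ne hne with h | h
  · exact hasTransfer_bigon hdis is₁ is₂ ht₁.1 h ht₂.2 hd₁ hd₂ hu₁ hu₂ (by tauto) hun₀ hun₁
  · exact hasTransfer_bigon hdis is₂ is₁ ht₂.1 h ht₁.2 hd₂ hd₁ hu₂ hu₁ hsign hun₀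
      fun x hx hu => (hun₁ x hx hu).symm

/-- The signs persist and both order conditions are negated, so the transfer maps of the two
triangles are related exactly as in `triangleMap_not`. -/
theorem Reidemeister3.nonempty_coloringQuiver_iso (h : Reidemeister3 L L') :
    Nonempty ((coloringQuiver X S L).Iso (coloringQuiver X S L')) := by
  obtain ⟨σ, hloc, s, s', hT, hT', hrev, hsign⟩ := h
  refine hloc.nonempty_coloringQuiver_iso S (hT.endsSimple hloc) (hT'.endsSimple hloc.symm)
    (hT.hasTransfer hloc) ?_
  have ht' := hT'.hasTransfer (X := X.carrier) hloc.symm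
  rw [← propext (hsign 0 1 (by decide)), ← propext (hsign 0 2 (by decide)),
    ← propext (hsign 1 2 (by decide))] at ht'
  have rev : ∀ i j k : Fin 3, i ≠ j → i ≠ k → j ≠ k → (s' i j < s' i k ↔ ¬ s i j < s i k) := by
    intro i j k hij hik hjk
    rw [hrev i j k hij hik hjk, not_lt]
    exact ⟨le_of_lt, fun h => lt_of_le_of_ne h (hT'.ne hloc.1 hij hik hjk)⟩
  rw [propext (rev 2 0 1 (by decide) (by decide) (by decide)),
    propext (rev 1 2 0 (by decide) (by decide) (by decide)), triangleMap_not] at ht'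
  · exact ht'
  -- The side condition seen from the top strand compares its signs with strands `1` and `2` with
  -- the orders along these two strands, which is the hypothesis of `triangleMap_not`.
  · have h := hT.2.2.2 0 1 2 (by decide) (by decide) (by decide)
    have hlt : s 2 1 < s 2 0 ↔ ¬ s 2 0 < s 2 1 := by
      rw [not_lt]
      exact ⟨le_of_lt, fun h => lt_of_le_of_ne h
        (hT.ne hloc.1 (by decide) (by decide) (by decide))⟩
    rwa [hlt] at h

theorem Move.nonempty_coloringQuiver_iso (h : Move L L') :
    Nonempty ((coloringQuiver X S L).Iso (coloringQuiver X S L')) := by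
  cases h with
  | reparam h =>
    obtain ⟨e, e', h, h', H, hend⟩ := exists_combIso_of_reparam h
    exact H.nonempty_coloringQuiver_iso S hend
  | isotopy h => exact (combIso_of_isotopy h).nonempty_coloringQuiver_iso S fun _ => rfl
  | sMove h => exact h.nonempty_coloringQuiver_iso S
  | reidemeister1 h => exact h.nonempty_coloringQuiver_iso S
  | reidemeister2 h => exact h.nonempty_coloringQuiver_iso S
  | reidemeister3 h => exact h.nonempty_coloringQuiver_iso S

theorem Equivalent.nonempty_coloringQuiver_iso (h : L.Equivalent L') :
    Nonempty ((coloringQuiver X S L).Iso (coloringQuiver X S L')) := by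
  induction h with
  | rel _ _ h => exact Move.nonempty_coloringQuiver_iso S h
  | refl => exact ⟨⟨Equiv.refl _, fun _ _ => rfl⟩⟩
  | symm _ _ _ ih =>
    obtain ⟨f⟩ := ih
    exact ⟨⟨f.toEquiv.symm, fun a b => by rw [← f.w_eq]; simp⟩⟩
  | trans _ _ _ _ _ ih ih' =>
    obtain ⟨f⟩ := ih
    obtain ⟨g⟩ := ih'
    exact ⟨⟨f.toEquiv.trans g.toEquiv, fun a b => by simp [g.w_eq, f.w_eq]⟩⟩

end

end LinkoidDiagram

theorem mainTheorem3 {n : ℕ} (X : PointedQuandle.{u} (2 * n)) [Finite X.carrier]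
    (S : Set X.End) :
    (∀ {m : ℕ} (L L' : LinkoidDiagram n m), L.Equivalent L' →
      Nonempty ((coloringQuiver X S L).Iso (coloringQuiver X S L'))) ∧
    ∀ {ι : Sort*} (F : DirectedMultigraph.{u} → ι),
      (∀ G H : DirectedMultigraph.{u}, Nonempty (G.Iso H) → F G = F H) →
      ∀ {m : ℕ} (L L' : LinkoidDiagram n m), L.Equivalent L' →
        F (coloringQuiver X S L) = F (coloringQuiver X S L') := by
  refine ⟨fun L L' h => h.nonempty_coloringQuiver_iso S, fun F hF _ L L' h => hF _ _ ?_⟩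
  exact h.nonempty_coloringQuiver_iso S
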